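/- Let $U$ be a real separable Hilbert space and let $\Lambda:D(\Lambda)\subset U\to U$ be a positive self-adjoint operator which has a trace class inverse $\Lambda^{-1}:U\to U$. Let $V=D(\Lambda^{1/2})$ with inner product $\langle\Lambda^{1/2}x,\Lambda^{1/2}y\rangle_U$, let $V'$ be its dual space, embed $U\subset V'$ by $u\mapsto\langle u,\cdot\rangle_U$, extend $\Lambda$ to the operator on $V'$ with domain $V$ given by $(\Lambda v)(w)=\langle v,w\rangle_V$, and let $H=U\times V'$ with the Hilbert norm $\|(x_1,x_2)\|_H^2=\|x_1\|_U^2+\|x_2\|_{V'}^2$. Let $\rho>0$ and $\alpha\in[0,1)$, and assume that $\rho^2\neq 4\mu^{1-2\alpha}$ for every eigenvalue $\mu$ of $\Lambda$. Let $$\mathcal A_{\alpha,\rho}(x_1,x_2)=(x_2,\,-\Lambda x_1-\rho\Lambda^\alpha x_2),\qquad D(\mathcal A_{\alpha,\rho})=\{(x_1,x_2)\in H:\ x_1\in V,\ x_2\in U\cap D(\Lambda^\alpha)\},$$ where $\Lambda^\alpha$ is the power of the extended operator on $V'$, and let $G:U\to H$, $Gu=(0,u)$. Then (the closure of) $\mathcal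 A_{\alpha,\rho}$ generates a strongly continuous semigroup $(e^{t\mathcal A_{\alpha,\rho}})_{t\ge0}$ on $H$, and the following holds, where $\|\cdot\|_{L_2(U,H)}$ is the Hilbert--Schmidt norm. 1. $\displaystyle\sup_{t\ge0}\|e^{t\mathcal A_{\alpha,\rho}}G\|_{L_2(U,H)}<\infty$. 2. Consequently $\displaystyle\int_0^T t^{-2\gamma}\,\|e^{t\mathcal A_{\alpha,\rho}}G\|^2_{L_2(U,H)}\,dt<\infty$ for all $T>0$ and $\gamma\in(0,\tfrac12)$. 3. Consequently the stochastic convolution of the linear equation $dX_t=\mathcal A_{\alpha,\rho}X_t\,dt+G\,dW_t$ is well defined in $H$: for every cylindrical Wiener process $W$ on $U$, defined on any probability space $(\Omega,\mathcal F,\mathbb P)$, and every $t\ge0$, the stochastic integral $\int_0^t e^{(t-s)\mathcal A_{\alpha,\rho}}G\,dW_s$ (the $L^2(\Omega;H)$-limit of the integrals of elementary integrands which approximate $s\mapsto e^{(t-s)\mathcal A_{\alpha,\rho}}G$ in $L^2((0,t];L_2(U,H))$) exists and is unique up to $\mathbb P$-null sets. -/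

import Mathlib

open Set Filter Topology MeasureTheory ProbabilityTheory
open scoped NNReal ENNReal InnerProductSpace

noncomputable section

namespace DampedWave

/-! ### Operators: trace class, Hilbert-Schmidt norm, eigenspaces, fractional powers -/

section Operators

variable {E F : Type*} [NormedAddCommGroup E] [InnerProductSpace ℝ E]

/-- Trace class (nuclear) operators: `T x = ∑ ⟪a n, x⟫ b n` with `∑ ‖a n‖ ‖b n‖ < ∞`. -/
def IsTraceClass (T : E →L[ℝ] E) : Prop :=
  ∃ a b : ℕ → E, Summable (fun n => ‖a n‖ * ‖b n‖) ∧
    ∀ x, HasSum (fun n => ⟪a n, x⟫_ℝ • b n) (T x)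

/-- `K` is the (everywhere defined, bounded) inverse of the unbounded operator `L`. -/
def IsInverse (L : E →ₗ.[ℝ] E) (K : E →L[ℝ] E) : Prop :=
  (∀ x : L.domain, K (L x) = x) ∧ ∀ y : E, ∃ h : K y ∈ L.domain, L ⟨K y, h⟩ = y

/-- Positive self-adjoint operators which have a trace class inverse. -/
structure IsAdmissible [CompleteSpace E] (L : E →ₗ.[ℝ] E) : Prop where
  selfAdjoint : IsSelfAdjoint L
  nonneg : ∀ x : L.domain, 0 ≤ ⟪L x, (x : E)⟫_ℝ
  inverse : ∃ K : E →L[ℝ] E, IsInverse L K ∧ IsTraceClass K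

/-- The eigenspace `{x ∈ D(L) : L x = m x}`. -/
def eigenspace (L : E →ₗ.[ℝ] E) (m : ℝ) : Submodule ℝ E where
  carrier := {x | ∃ h : x ∈ L.domain, L ⟨x, h⟩ = m • x}
  zero_mem' := ⟨L.domain.zero_mem, by
    have : (⟨0, L.domain.zero_mem⟩ : L.domain) = 0 := rfl
    rw [this, L.map_zero, smul_zero]⟩
  add_mem' := by
    rintro x y ⟨hx, hx'⟩ ⟨hy, hy'⟩
    refine ⟨L.domain.add_mem hx hy, ?_⟩
    have : (⟨x + y, L.domain.add_mem hx hy⟩ : L.domain) = ⟨x, hx⟩ + ⟨y, hy⟩ := rfl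
    rw [this, L.map_add, hx', hy', smul_add]
  smul_mem' := by
    rintro c x ⟨hx, hx'⟩
    refine ⟨L.domain.smul_mem c hx, ?_⟩
    have : (⟨c • x, L.domain.smul_mem c hx⟩ : L.domain) = c • ⟨x, hx⟩ := rfl
    rw [this, L.map_smul, hx', smul_comm]

/-- `m` is an eigenvalue of `L`. -/
def IsEigenvalue (L : E →ₗ.[ℝ] E) (m : ℝ) : Prop := eigenspace L m ≠ ⊥

/-- The orthogonal projection onto the eigenspace of `m`. The eigenspaces of a self-adjoint
operator are closed, so that the closure changes nothing there. -/
def eigenproj [CompleteSpace E] (L : E →ₗ.[ℝ] E) (m : ℝ) : E →L[ℝ] E :=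
  (eigenspace L m).topologicalClosure.starProjection

/-- The power `L ^ s` of a positive self-adjoint operator whose eigenvectors are complete, through
its spectral decomposition: `L ^ s x = ∑ m ^ s P_m x`, the sum being over the eigenvalues `m` of `L`
(`P_m = 0` for the other `m`), with the set of all `x` for which this series
converges as its domain. The terms are mutually orthogonal, so that this
is the condition `∑ m ^ (2 s) ‖P_m x‖ ^ 2 < ∞`. -/
def fracPow [CompleteSpace E] (L : E →ₗ.[ℝ] E) (s : ℝ) : E →ₗ.[ℝ] E where
  domain :=
    { carrier := {x | Summable fun m : ℝ => m ^ s • eigenproj L m x}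
      zero_mem' := by simp [summable_zero]
      add_mem' := by
        intro x y hx hy
        simpa only [mem_ofPred_eq, map_add, smul_add] using Summable.add hx hy
      smul_mem' := by
        intro c x hx
        have h := Summable.const_smul c hx
        simp only [mem_ofPred_eq, map_smul]
        refine h.congr fun m => ?_
        rw [smul_comm] }
  toFun :=
    { toFun := fun x => ∑' m : ℝ, m ^ s • eigenproj L m (x : E)
      map_add' := by
        rintro ⟨x, hx⟩ ⟨y, hy⟩
        simp only [Submodule.coe_add, map_add, smul_add]
        exact Summable.tsum_add hx hy
      map_smul' := by
        rintro c ⟨x, hx⟩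
        simp only [Submodule.coe_smul, map_smul, RingHom.id_apply]
        rw [← Summable.tsum_const_smul c hx]
        exact tsum_congr fun m => smul_comm _ _ _ }

/-- The Hilbert-Schmidt norm `(∑ ‖T e_i‖ ^ 2) ^ (1/2)`, with `(e_i)` an
orthonormal basis; it is `∞` if `T` is not a Hilbert-Schmidt operator. It does not depend on the
basis, see `hsNorm_eq`. -/
def hsNorm [CompleteSpace E] [NormedAddCommGroup F] [NormedSpace ℝ F] (T : E →L[ℝ] F) : ℝ≥0∞ :=
  (∑' i : (exists_hilbertBasis ℝ E).choose,
    ‖T ((exists_hilbertBasis ℝ E).choose_spec.choose i)‖ₑ ^ 2) ^ (1 / 2 : ℝ)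

lemma enorm_sq_eq_tsum {ι : Type*} (b : HilbertBasis ι ℝ E) (x : E) :
    ‖x‖ₑ ^ 2 = ∑' i, ‖⟪b i, x⟫_ℝ‖ₑ ^ 2 := by
  have h := b.hasSum_inner_mul_inner x x
  have h2 : HasSum (fun i => ‖⟪b i, x⟫_ℝ‖ ^ 2) (‖x‖ ^ 2) := by
    rw [← real_inner_self_eq_norm_sq]
    refine h.congr_fun ?_ |> id
    intro i
    rw [real_inner_comm x (b i), Real.norm_eq_abs, sq_abs, sq]
  have e : ∀ {G : Type _} [NormedAddCommGroup G] (y : G), ‖y‖ₑ ^ 2 = ENNReal.ofReal (‖y‖ ^ 2) := by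
    intro G _ y
    rw [ENNReal.ofReal_pow (norm_nonneg _), ofReal_norm]
  rw [e x, ← h2.tsum_eq, ENNReal.ofReal_tsum_of_nonneg (fun _ => sq_nonneg _) h2.summable]
  refine tsum_congr fun i => ?_
  rw [ENNReal.ofReal_pow (norm_nonneg _), ofReal_norm]

lemma tsum_enorm_sq_eq [CompleteSpace E] [NormedAddCommGroup F] [InnerProductSpace ℝ F]
    [CompleteSpace F] {ι κ : Type*} (b : HilbertBasis ι ℝ E) (c : HilbertBasis κ ℝ F)
    (T : E →L[ℝ] F) :
    ∑' i, ‖T (b i)‖ₑ ^ 2 = ∑' j, ‖ContinuousLinearMap.adjoint T (c j)‖ₑ ^ 2 := by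
  simp_rw [enorm_sq_eq_tsum c (T _), enorm_sq_eq_tsum b (ContinuousLinearMap.adjoint T _)]
  rw [ENNReal.tsum_comm]
  refine tsum_congr fun j => tsum_congr fun i => ?_
  rw [ContinuousLinearMap.adjoint_inner_right, real_inner_comm]

lemma hsNorm_eq [CompleteSpace E] [NormedAddCommGroup F] [InnerProductSpace ℝ F]
    [CompleteSpace F] {ι : Type*} (b : HilbertBasis ι ℝ E) (T : E →L[ℝ] F) :
    hsNorm T = (∑' i, ‖T (b i)‖ₑ ^ 2) ^ (1 / 2 : ℝ) := by
  obtain ⟨w, c, -⟩ := exists_hilbertBasis ℝ F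
  rw [hsNorm, tsum_enorm_sq_eq _ c, tsum_enorm_sq_eq b c]

/-- Strongly continuous semigroups of bounded operators (only the values at `t ≥ 0` matter). -/
structure IsC0Semigroup (S : ℝ → E →L[ℝ] E) : Prop where
  zero : S 0 = ContinuousLinearMap.id ℝ E
  add : ∀ s t, 0 ≤ s → 0 ≤ t → S (s + t) = (S s).comp (S t)
  continuousOn : ∀ x, ContinuousOn (fun t => S t x) (Ici 0)

/-- `S` is the strongly continuous semigroup generated by (the closure of) `A`: its infinitesimal
generator `x ↦ lim_{t → 0+} (S t x - x) / t` has the closure of the graph of `A` as its graph. -/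
def Generates (A : E →ₗ.[ℝ] E) (S : ℝ → E →L[ℝ] E) : Prop :=
  IsC0Semigroup S ∧ ∀ x y : E, (x, y) ∈ A.graph.topologicalClosure ↔
    Tendsto (fun t : ℝ => t⁻¹ • (S t x - x)) (𝓝[>] 0) (𝓝 y)

end Operators

/-! ### Spectral facts which the spaces below rest on -/

section Spectral

variable {U : Type*} [NormedAddCommGroup U] [InnerProductSpace ℝ U] [CompleteSpace U]
  {L : U →ₗ.[ℝ] U}

lemma IsTraceClass.isCompactOperator {K : U →L[ℝ] U} (hK : IsTraceClass K) :
    IsCompactOperator K := by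
  obtain ⟨a, b, hs, hK⟩ := hK
  let R : ℕ → U →L[ℝ] U := fun n => (innerSL ℝ (a n)).smulRight (b n)
  have hR : ∀ n, ‖R n‖ ≤ ‖a n‖ * ‖b n‖ := fun n => by
    simp [R, ContinuousLinearMap.norm_smulRight_apply]
  have hsum : Summable R := Summable.of_norm_bounded hs hR
  have hKR : K = ∑' n, R n := by
    ext x
    have h1 : HasSum (fun n => (ContinuousLinearMap.apply ℝ U x) (R n))
        ((ContinuousLinearMap.apply ℝ U x) (∑' n, R n)) :=
      hsum.hasSum.mapL (ContinuousLinearMap.apply ℝ U x)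
    have h2 : HasSum (fun n => ⟪a n, x⟫_ℝ • b n) ((∑' n, R n) x) := by
      simpa [R] using h1
    exact (hK x).unique h2
  rw [hKR]
  refine isCompactOperator_of_tendsto hsum.hasSum (Eventually.of_forall fun s => ?_)
  have hc : ∀ n, R n ∈ compactOperator (RingHom.id ℝ) U U := fun n => by
    change IsCompactOperator (R n)
    have h1 : IsCompactOperator (innerSL ℝ (a n)) := by
      exact isCompactOperator_id.comp_clm (innerSL ℝ (a n))
    exact h1.clm_comp (ContinuousLinearMap.toSpanSingleton ℝ (b n))
  exact Submodule.sum_mem (compactOperator (RingHom.id ℝ) U U) fun n _ => hc n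

lemma IsAdmissible.symm (hL : IsAdmissible L) (x y : L.domain) :
    ⟪L x, (y : U)⟫_ℝ = ⟪(x : U), L y⟫_ℝ := by
  have h := LinearPMap.adjoint_isFormalAdjoint (T := L) hL.selfAdjoint.dense_domain
  rw [LinearPMap.isSelfAdjoint_def.1 hL.selfAdjoint] at h
  exact h x y

lemma IsAdmissible.pos (hL : IsAdmissible L) {m : ℝ} {x : U} (hx : x ∈ eigenspace L m)
    (hm : m ≤ 0) : x = 0 := by
  obtain ⟨K, hK, -⟩ := hL.inverse
  obtain ⟨h, hx⟩ := hx
  have h1 := hL.nonneg ⟨x, h⟩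
  rw [hx, real_inner_smul_left] at h1
  by_contra hne
  have h2 : 0 < ⟪x, x⟫_ℝ := real_inner_self_pos.2 hne
  have h3 : m = 0 := le_antisymm hm (by
    by_contra h4
    exact absurd h1 (not_le.2 (mul_neg_of_neg_of_pos (not_le.1 h4) h2)))
  have h5 := hK.1 ⟨x, h⟩
  rw [hx, h3] at h5
  simp only [zero_smul, map_zero] at h5
  exact hne h5.symm

/-- The eigenvectors are complete. -/
lemma IsAdmissible.complete (hL : IsAdmissible L) {x : U}
    (hx : ∀ m, ∀ y ∈ eigenspace L m, ⟪y, x⟫_ℝ = 0) : x = 0 := by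
  obtain ⟨K, hK, hT⟩ := hL.inverse
  have hsymm : (K : U →ₗ[ℝ] U).IsSymmetric := by
    intro y z
    obtain ⟨hy, hy'⟩ := hK.2 y
    obtain ⟨hz, hz'⟩ := hK.2 z
    have := hL.symm ⟨K y, hy⟩ ⟨K z, hz⟩
    rw [hy', hz'] at this
    exact this.symm
  have h := ContinuousLinearMap.orthogonalComplement_iSup_eigenspaces_eq_bot
    hT.isCompactOperator hsymm
  have hmem : x ∈ (⨆ m, Module.End.eigenspace (K : U →ₗ[ℝ] U) m)ᗮ := by
    rw [Submodule.mem_orthogonal]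
    intro y hy
    refine Submodule.iSup_induction _ (motive := fun y => ⟪y, x⟫_ℝ = 0) hy ?_ (by simp) ?_
    · intro k y hy
      rw [Module.End.mem_eigenspace_iff] at hy
      have hy : K y = k • y := hy
      obtain ⟨hd, hLK⟩ := hK.2 y
      by_cases hk : k = 0
      · have h0 : (⟨K y, hd⟩ : L.domain) = 0 := by
          ext
          simp [hy, hk]
        rw [h0, L.map_zero] at hLK
        rw [← hLK, inner_zero_left]
      · have hyd : y ∈ L.domain := by
          have := L.domain.smul_mem k⁻¹ hd
          rwa [hy, smul_smul, inv_mul_cancel₀ hk, one_smul] at this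
        refine hx k⁻¹ y ⟨hyd, ?_⟩
        have h1 : (⟨K y, hd⟩ : L.domain) = k • ⟨y, hyd⟩ := by
          ext
          simp [hy]
        rw [h1, L.map_smul] at hLK
        have h2 := congrArg (fun z => k⁻¹ • z) hLK
        simpa only [smul_smul, inv_mul_cancel₀ hk, one_smul] using h2
    · intro y z hy hz
      rw [inner_add_left, hy, hz, add_zero]
  rw [h] at hmem
  exact (Submodule.mem_bot ℝ).1 hmem

lemma IsAdmissible.closure_eigenspace (hL : IsAdmissible L) (m : ℝ) :
    (eigenspace L m).topologicalClosure = eigenspace L m := by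
  refine IsClosed.submodule_topologicalClosure_eq ?_
  have hc : IsClosed (L.graph : Set (U × U)) := hL.selfAdjoint.isClosed
  have he : (eigenspace L m : Set U) = (fun x : U => (x, m • x)) ⁻¹' (L.graph : Set (U × U)) := by
    ext x
    constructor
    · rintro ⟨h, hx⟩
      exact (LinearPMap.mem_graph_iff L).2 ⟨⟨x, h⟩, rfl, hx⟩
    · intro h
      obtain ⟨y, hy, hy'⟩ := (LinearPMap.mem_graph_iff L).1 h
      obtain rfl : (y : U) = x := hy
      exact ⟨y.2, hy'⟩
  rw [he]
  exact hc.preimage (by fun_prop)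

lemma IsAdmissible.eigenproj_mem (hL : IsAdmissible L) (m : ℝ) (x : U) :
    eigenproj L m x ∈ eigenspace L m := by
  rw [← hL.closure_eigenspace m]
  exact Submodule.starProjection_apply_mem _ _

lemma IsAdmissible.ortho (hL : IsAdmissible L) {m k : ℝ} (hmk : m ≠ k) {x y : U}
    (hx : x ∈ eigenspace L m) (hy : y ∈ eigenspace L k) : ⟪x, y⟫_ℝ = 0 := by
  obtain ⟨hx, hx'⟩ := hx
  obtain ⟨hy, hy'⟩ := hy
  have h := hL.symm ⟨x, hx⟩ ⟨y, hy⟩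
  rw [hx', hy', real_inner_smul_left, real_inner_smul_right] at h
  have h2 : (m - k) * ⟪x, y⟫_ℝ = 0 := by
    rw [sub_mul]
    exact sub_eq_zero.2 h
  exact (mul_eq_zero.1 h2).resolve_left (sub_ne_zero.2 hmk)

lemma eigenproj_inner (m : ℝ) (x y : U) :
    ⟪eigenproj L m x, y⟫_ℝ = ⟪x, eigenproj L m y⟫_ℝ :=
  Submodule.inner_starProjection_left_eq_right _ _ _

lemma eigenproj_of_mem {m : ℝ} {x : U} (hx : x ∈ eigenspace L m) : eigenproj L m x = x :=
  Submodule.starProjection_eq_self_iff.2 (Submodule.le_topologicalClosure _ hx)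

lemma IsAdmissible.eigenproj_eigenproj (hL : IsAdmissible L) {m k : ℝ} (hmk : m ≠ k) (x : U) :
    eigenproj L k (eigenproj L m x) = 0 := by
  rw [← inner_self_eq_zero (𝕜 := ℝ), eigenproj_inner]
  refine hL.ortho hmk (hL.eigenproj_mem m x) ?_
  rw [eigenproj_of_mem (hL.eigenproj_mem k _)]
  exact hL.eigenproj_mem k _

lemma IsAdmissible.eq_of_eigenproj (hL : IsAdmissible L) {x y : U}
    (h : ∀ m, eigenproj L m x = eigenproj L m y) : x = y := by
  refine sub_eq_zero.1 (hL.complete fun m z hz => ?_)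
  rw [← eigenproj_of_mem hz, eigenproj_inner, map_sub, h m, sub_self, inner_zero_right]

/-- The projections of a convergent eigenfunction expansion. -/
lemma IsAdmissible.eigenproj_tsum (hL : IsAdmissible L) {c : ℝ → ℝ} {x : U}
    (h : Summable fun m => c m • eigenproj L m x) (k : ℝ) :
    eigenproj L k (∑' m, c m • eigenproj L m x) = c k • eigenproj L k x := by
  rw [ContinuousLinearMap.map_tsum _ h, tsum_eq_single k]
  · rw [map_smul, eigenproj_of_mem (hL.eigenproj_mem k x)]
  · intro m hm
    rw [map_smul, hL.eigenproj_eigenproj hm, smul_zero]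

lemma IsAdmissible.orthogonalFamily (hL : IsAdmissible L) :
    OrthogonalFamily ℝ (fun m : ℝ => eigenspace L m) fun m => (eigenspace L m).subtypeₗᵢ := by
  intro m k hmk x y
  exact hL.ortho hmk x.2 y.2

lemma IsAdmissible.summable_of_bound (hL : IsAdmissible L) {c : ℝ → ℝ} {C : ℝ} {x : U}
    (h : ∀ m, ‖c m • eigenproj L m x‖ ≤ C * ‖eigenproj L m x‖) :
    Summable fun m => c m • eigenproj L m x := by
  have h1 : Summable fun m => ‖eigenproj L m x‖ ^ 2 := by
    refine summable_of_sum_le (c := ‖x‖ ^ 2) (fun _ => sq_nonneg _) fun s => ?_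
    have e1 := hL.orthogonalFamily.norm_sum (fun m => ⟨eigenproj L m x, hL.eigenproj_mem m x⟩) s
    change ‖∑ m ∈ s, eigenproj L m x‖ ^ 2 = ∑ m ∈ s, ‖eigenproj L m x‖ ^ 2 at e1
    have e2 : ∑ m ∈ s, ‖eigenproj L m x‖ ^ 2 = ⟪∑ m ∈ s, eigenproj L m x, x⟫_ℝ := by
      rw [sum_inner]
      refine Finset.sum_congr rfl fun m _ => ?_
      rw [← real_inner_self_eq_norm_sq, ← eigenproj_inner,
        eigenproj_of_mem (hL.eigenproj_mem m x)]
    have e3 := real_inner_le_norm (∑ m ∈ s, eigenproj L m x) x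
    rw [← e2, ← e1] at e3
    rw [← e1]
    nlinarith [norm_nonneg (∑ m ∈ s, eigenproj L m x), norm_nonneg x]
  have h2 := (hL.orthogonalFamily.summable_iff_norm_sq_summable
    (fun m => ⟨c m • eigenproj L m x, (eigenspace L m).smul_mem _ (hL.eigenproj_mem m x)⟩)).2
  refine h2 ?_
  refine Summable.of_nonneg_of_le (fun _ => sq_nonneg _) (fun m => ?_) (h1.mul_left (C ^ 2))
  rw [← mul_pow]
  exact pow_le_pow_left₀ (norm_nonneg _) (h m) 2

lemma IsAdmissible.negHalf_domain (hL : IsAdmissible L) (x : U) :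
    x ∈ (fracPow L (-1 / 2)).domain := by
  obtain ⟨K, hK, -⟩ := hL.inverse
  refine hL.summable_of_bound (c := fun m => m ^ (-1 / 2 : ℝ)) (C := ‖K‖ ^ (1 / 2 : ℝ)) fun m => ?_
  rw [norm_smul]
  by_cases h0 : eigenproj L m x = 0
  · simp [h0]
  refine mul_le_mul_of_nonneg_right ?_ (norm_nonneg _)
  have hm : 0 < m := by
    by_contra hm
    exact h0 (hL.pos (hL.eigenproj_mem m x) (not_lt.1 hm))
  obtain ⟨hd, he⟩ := hL.eigenproj_mem m x
  have h1 := hK.1 ⟨_, hd⟩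
  rw [he, map_smul] at h1
  have h2 : ‖eigenproj L m x‖ ≤ m * ‖K‖ * ‖eigenproj L m x‖ := by
    calc ‖eigenproj L m x‖ = ‖m • K (eigenproj L m x)‖ := by rw [h1]
      _ = m * ‖K (eigenproj L m x)‖ := by rw [norm_smul, Real.norm_of_nonneg hm.le]
      _ ≤ m * (‖K‖ * ‖eigenproj L m x‖) := by
        gcongr
        exact K.le_opNorm _
      _ = _ := by ring
  have h3 : 1 ≤ m * ‖K‖ := by
    have := norm_pos_iff.2 h0
    by_contra h4
    nlinarith
  have h4 : m⁻¹ ≤ ‖K‖ := by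
    rw [inv_le_iff_one_le_mul₀ hm]
    linarith
  rw [Real.norm_of_nonneg (Real.rpow_nonneg hm.le _),
    show (-1 / 2 : ℝ) = -(1 / 2) by norm_num, Real.rpow_neg hm.le, ← Real.inv_rpow hm.le]
  exact Real.rpow_le_rpow (inv_nonneg.2 hm.le) h4 (by norm_num)

/-- `L ^ (-1/2)`, which is defined everywhere. -/
def IsAdmissible.negHalf (hL : IsAdmissible L) : U →ₗ[ℝ] U :=
  (fracPow L (-1 / 2)).toFun ∘ₗ LinearMap.codRestrict _ LinearMap.id hL.negHalf_domain

lemma IsAdmissible.eigenproj_negHalf (hL : IsAdmissible L) (x : U) (m : ℝ) :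
    eigenproj L m (hL.negHalf x) = m ^ (-1 / 2 : ℝ) • eigenproj L m x :=
  hL.eigenproj_tsum (hL.negHalf_domain x) m

lemma IsAdmissible.negHalf_symm (hL : IsAdmissible L) : hL.negHalf.IsSymmetric := by
  intro x y
  have hx : HasSum (fun m => m ^ (-1 / 2 : ℝ) • eigenproj L m x) (hL.negHalf x) :=
    Summable.hasSum (hL.negHalf_domain x)
  have hy : HasSum (fun m => m ^ (-1 / 2 : ℝ) • eigenproj L m y) (hL.negHalf y) :=
    Summable.hasSum (hL.negHalf_domain y)
  have h1 := hx.mapL ((innerSL ℝ) y)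
  have h2 := hy.mapL ((innerSL ℝ) x)
  rw [real_inner_comm]
  refine h1.unique (h2.congr_fun ?_)
  intro m
  simp only [innerSL_apply_apply, real_inner_smul_right]
  rw [← eigenproj_inner, real_inner_comm]

lemma IsAdmissible.half_negHalf (hL : IsAdmissible L) (y : U) :
    ∃ h : hL.negHalf y ∈ (fracPow L (1 / 2)).domain, fracPow L (1 / 2) ⟨hL.negHalf y, h⟩ = y := by
  have h1 : ∀ m, m ^ (1 / 2 : ℝ) • eigenproj L m (hL.negHalf y) = (1 : ℝ) • eigenproj L m y := by
    intro m
    rw [hL.eigenproj_negHalf, smul_smul, one_smul]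
    rcases le_or_gt m 0 with hm | hm
    · rw [hL.pos (hL.eigenproj_mem m y) hm, smul_zero]
    · rw [← Real.rpow_add hm]
      norm_num
  have hs : Summable fun m : ℝ => (1 : ℝ) • eigenproj L m y :=
    hL.summable_of_bound (c := fun _ => 1) (C := 1) (by simp)
  refine ⟨hs.congr fun m => (h1 m).symm, ?_⟩
  change ∑' m : ℝ, m ^ (1 / 2 : ℝ) • eigenproj L m (hL.negHalf y) = y
  rw [tsum_congr h1]
  refine hL.eq_of_eigenproj fun k => ?_
  rw [hL.eigenproj_tsum (c := fun _ => 1) hs, one_smul]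

lemma IsAdmissible.negHalf_half (hL : IsAdmissible L) (x : (fracPow L (1 / 2)).domain) :
    hL.negHalf (fracPow L (1 / 2) x) = x := by
  refine hL.eq_of_eigenproj fun k => ?_
  rw [hL.eigenproj_negHalf]
  have : eigenproj L k (fracPow L (1 / 2) x) = k ^ (1 / 2 : ℝ) • eigenproj L k (x : U) :=
    hL.eigenproj_tsum x.2 k
  rw [this, smul_smul]
  rcases le_or_gt k 0 with hm | hm
  · rw [hL.pos (hL.eigenproj_mem k _) hm, smul_zero]
  · rw [← Real.rpow_add hm]
    norm_num

end Spectral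

/-! ### The spaces `V = D(Λ ^ (1/2))`, `V'` and `H = U × V'` -/

section Spaces

variable {U : Type*} [NormedAddCommGroup U] [InnerProductSpace ℝ U] [CompleteSpace U]
  {L : U →ₗ.[ℝ] U}

/-- `V = D(Λ ^ (1/2))`, with the inner product `⟪Λ ^ (1/2) x, Λ ^ (1/2) y⟫`. -/
def V (_ : IsAdmissible L) : Type _ := (fracPow L (1 / 2)).domain

instance (hL : IsAdmissible L) : AddCommGroup (V hL) :=
  inferInstanceAs (AddCommGroup (fracPow L (1 / 2)).domain)

instance (hL : IsAdmissible L) : Module ℝ (V hL) :=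
  inferInstanceAs (Module ℝ (fracPow L (1 / 2)).domain)

/-- The inclusion of `V` into `U`, as a linear map. -/
def V.val (hL : IsAdmissible L) : V hL →ₗ[ℝ] U := (fracPow L (1 / 2)).domain.subtype

/-- `Λ ^ (1/2)` on `V`. -/
def V.half (hL : IsAdmissible L) : V hL →ₗ[ℝ] U := (fracPow L (1 / 2)).toFun

lemma V.half_injective (hL : IsAdmissible L) : Function.Injective (V.half hL) := by
  intro x y h
  have h' := congrArg hL.negHalf h
  exact Subtype.ext ((hL.negHalf_half x).symm.trans (h'.trans (hL.negHalf_half y)))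

/-- The inner product of `V`. -/
@[reducible]
def V.core (hL : IsAdmissible L) : InnerProductSpace.Core ℝ (V hL) where
  inner x y := ⟪V.half hL x, V.half hL y⟫_ℝ
  conj_inner_symm x y := real_inner_comm _ _
  re_inner_nonneg x := real_inner_self_nonneg
  add_left x y z := by rw [map_add, inner_add_left]
  smul_left x y r := by
    rw [map_smul, real_inner_smul_left]
    rfl
  definite x h := V.half_injective hL (by
    rw [map_zero]
    exact inner_self_eq_zero.1 h)

instance (hL : IsAdmissible L) : NormedAddCommGroup (V hL) := (V.core hL).toNormedAddCommGroup

instance (hL : IsAdmissible L) : InnerProductSpace ℝ (V hL) :=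
  InnerProductSpace.ofCore (V.core hL).toCore

lemma V.inner_def (hL : IsAdmissible L) (x y : V hL) :
    ⟪x, y⟫_ℝ = ⟪V.half hL x, V.half hL y⟫_ℝ := rfl

lemma V.norm_half (hL : IsAdmissible L) (x : V hL) : ‖V.half hL x‖ = ‖x‖ := by
  rw [@norm_eq_sqrt_real_inner U, @norm_eq_sqrt_real_inner (V hL), V.inner_def]

/-- `Λ ^ (1/2)` maps `V` isometrically onto `U`. -/
def V.iso (hL : IsAdmissible L) : V hL ≃ₗᵢ[ℝ] U where
  toLinearEquiv := LinearEquiv.ofBijective (V.half hL) ⟨V.half_injective hL, fun y => by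
    obtain ⟨h, hy⟩ := hL.half_negHalf y
    exact ⟨⟨_, h⟩, hy⟩⟩
  norm_map' := V.norm_half hL

instance (hL : IsAdmissible L) : CompleteSpace (V hL) :=
  (completeSpace_congr (e := (V.iso hL).toEquiv) (V.iso hL).isometry.isUniformEmbedding).2
    inferInstance

/-- The continuous inclusion of `V` into `U`. -/
def V.incl (hL : IsAdmissible L) : V hL →L[ℝ] U where
  toLinearMap := V.val hL
  cont := by
    have h : ⇑(V.val hL) = hL.negHalf ∘ V.iso hL := funext fun x => (hL.negHalf_half x).symm
    change Continuous ⇑(V.val hL)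
    rw [h]
    exact hL.negHalf_symm.continuous.comp (V.iso hL).continuous

/-- The dual space `V'` of `V`, with the dual norm. -/
def DualV (hL : IsAdmissible L) : Type _ := StrongDual ℝ (V hL)

instance (hL : IsAdmissible L) : NormedAddCommGroup (DualV hL) :=
  inferInstanceAs (NormedAddCommGroup (StrongDual ℝ (V hL)))

/-- `V'` is a Hilbert space: its norm comes from the inner product that
the Riesz isomorphism transports from `V`. -/
instance (hL : IsAdmissible L) : InnerProductSpace ℝ (DualV hL) where
  toNormedSpace := inferInstanceAs (NormedSpace ℝ (StrongDual ℝ (V hL)))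
  inner f g := ⟪(InnerProductSpace.toDual ℝ (V hL)).symm f,
    (InnerProductSpace.toDual ℝ (V hL)).symm g⟫_ℝ
  norm_sq_eq_re_inner f :=
    (congrArg (· ^ 2)
      (LinearIsometryEquiv.norm_map (InnerProductSpace.toDual ℝ (V hL)).symm f).symm).trans
      (norm_sq_eq_re_inner (𝕜 := ℝ) ((InnerProductSpace.toDual ℝ (V hL)).symm f))
  conj_inner_symm f g := real_inner_comm _ _
  add_left f g h := by
    refine Eq.trans ?_ (inner_add_left (𝕜 := ℝ) _ _ _)
    exact congrArg (fun z => ⟪z, (InnerProductSpace.toDual ℝ (V hL)).symm h⟫_ℝ)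
      (map_add (InnerProductSpace.toDual ℝ (V hL)).symm f g)
  smul_left f g r := by
    refine Eq.trans ?_ (inner_smul_left (𝕜 := ℝ) _ _ _)
    exact congrArg (fun z => ⟪z, (InnerProductSpace.toDual ℝ (V hL)).symm g⟫_ℝ)
      (LinearIsometryEquiv.map_smulₛₗ (InnerProductSpace.toDual ℝ (V hL)).symm r f)

instance (hL : IsAdmissible L) : CompleteSpace (DualV hL) :=
  inferInstanceAs (CompleteSpace (StrongDual ℝ (V hL)))

/-- The identification of `V'` with Mathlib's dual space. -/
def DualV.equiv (hL : IsAdmissible L) : DualV hL ≃ₗᵢ[ℝ] StrongDual ℝ (V hL) where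
  toFun f := f
  invFun f := f
  map_add' _ _ := rfl
  map_smul' _ _ := rfl
  left_inv _ := rfl
  right_inv _ := rfl
  norm_map' _ := rfl

/-- The embedding of `U` into `V'`: `u` acts on `V` as `v ↦ ⟪u, v⟫_U`. -/
def emb (hL : IsAdmissible L) : U →L[ℝ] DualV hL :=
  LinearMap.mkContinuous
    ((DualV.equiv hL).symm.toLinearEquiv.toLinearMap ∘ₗ
      { toFun := fun u => (innerSL ℝ u).comp (V.incl hL)
        map_add' := fun u v => by rw [map_add, ContinuousLinearMap.add_comp]
        map_smul' := fun r u => by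
          ext v
          simp })
    ‖V.incl hL‖ fun u => by
      change ‖(innerSL ℝ u).comp (V.incl hL)‖ ≤ _
      refine (ContinuousLinearMap.opNorm_comp_le _ _).trans ?_
      rw [innerSL_apply_norm, mul_comm]

lemma emb_apply (hL : IsAdmissible L) (u : U) (v : V hL) :
    DualV.equiv hL (emb hL u) v = ⟪u, V.incl hL v⟫_ℝ := rfl

lemma emb_injective (hL : IsAdmissible L) : Function.Injective (emb hL) := by
  rw [injective_iff_map_eq_zero]
  intro u hu
  have h1 : hL.negHalf u = 0 := by
    refine ext_inner_right ℝ fun y => ?_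
    obtain ⟨h, -⟩ := hL.half_negHalf y
    have h2 := emb_apply hL u ⟨hL.negHalf y, h⟩
    rw [hu, LinearIsometryEquiv.map_zero] at h2
    rw [hL.negHalf_symm u y, inner_zero_left]
    exact h2.symm
  refine hL.eq_of_eigenproj fun m => ?_
  have h3 := hL.eigenproj_negHalf u m
  rw [h1, map_zero] at h3
  rw [map_zero]
  rcases le_or_gt m 0 with hm | hm
  · exact hL.pos (hL.eigenproj_mem m u) hm
  · exact (smul_eq_zero.1 h3.symm).resolve_left (Real.rpow_pos_of_pos hm _).ne'

/-- `Λ` as a map from `V` to `V'`: `(Λ v) w = ⟪Λ ^ (1/2) v, Λ ^ (1/2) w⟫_U = ⟪v, w⟫_V`. -/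
def lapl (hL : IsAdmissible L) : V hL →ₗ[ℝ] DualV hL :=
  (DualV.equiv hL).symm.toLinearEquiv.toLinearMap ∘ₗ
    { toFun := fun v => innerSL ℝ v
      map_add' := fun v w => map_add _ v w
      map_smul' := fun r v => by
        ext w
        simp }

lemma lapl_apply (hL : IsAdmissible L) (v w : V hL) :
    DualV.equiv hL (lapl hL v) w = ⟪v, w⟫_ℝ := rfl

/-- The inclusion of `V` into `V'`. -/
def embV (hL : IsAdmissible L) : V hL →ₗ[ℝ] DualV hL := (emb hL).toLinearMap ∘ₗ V.val hL

lemma embV_injective (hL : IsAdmissible L) : Function.Injective (embV hL) :=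
  (emb_injective hL).comp Subtype.val_injective

/-- The extension of `Λ` to an unbounded operator in `V'` with domain `V`. -/
def extOp (hL : IsAdmissible L) : DualV hL →ₗ.[ℝ] DualV hL where
  domain := LinearMap.range (embV hL)
  toFun := lapl hL ∘ₗ (LinearEquiv.ofInjective (embV hL) (embV_injective hL)).symm.toLinearMap

/-- `H = U × V'`, with the norm `‖(x₁, x₂)‖ ^ 2 = ‖x₁‖_U ^ 2 + ‖x₂‖_{V'} ^ 2`. -/
def H (hL : IsAdmissible L) : Type _ := WithLp 2 (U × DualV hL)

instance (hL : IsAdmissible L) : NormedAddCommGroup (H hL) :=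
  inferInstanceAs (NormedAddCommGroup (WithLp 2 (U × DualV hL)))

instance (hL : IsAdmissible L) : InnerProductSpace ℝ (H hL) :=
  inferInstanceAs (InnerProductSpace ℝ (WithLp 2 (U × DualV hL)))

instance (hL : IsAdmissible L) : CompleteSpace (H hL) :=
  inferInstanceAs (CompleteSpace (WithLp 2 (U × DualV hL)))

/-- The linear identification of `H` with the product `U × V'`. -/
def H.equiv (hL : IsAdmissible L) : H hL ≃L[ℝ] U × DualV hL where
  toLinearEquiv := WithLp.linearEquiv 2 ℝ (U × DualV hL)
  continuous_toFun := WithLp.prod_continuous_ofLp 2 U (DualV hL)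
  continuous_invFun := WithLp.prod_continuous_toLp 2 U (DualV hL)

lemma H.norm_sq (hL : IsAdmissible L) (x : H hL) :
    ‖x‖ ^ 2 = ‖(H.equiv hL x).1‖ ^ 2 + ‖(H.equiv hL x).2‖ ^ 2 :=
  WithLp.prod_norm_sq_eq_of_L2 (α := U) (β := DualV hL) x

/-- The component of an element of `H` in `U`. -/
def H.fst (hL : IsAdmissible L) : H hL →ₗ[ℝ] U :=
  LinearMap.fst ℝ U (DualV hL) ∘ₗ (H.equiv hL).toLinearEquiv.toLinearMap

/-- The component of an element of `H` in `V'`. -/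
def H.snd (hL : IsAdmissible L) : H hL →ₗ[ℝ] DualV hL :=
  LinearMap.snd ℝ U (DualV hL) ∘ₗ (H.equiv hL).toLinearEquiv.toLinearMap

/-- `G u = (0, u)`. -/
def G (hL : IsAdmissible L) : U →L[ℝ] H hL :=
  (H.equiv hL).symm.toContinuousLinearMap.comp
    ((ContinuousLinearMap.inr ℝ U (DualV hL)).comp (emb hL))

/-- The domain of the operator matrix: all `(x₁, x₂)` with `x₁ ∈ V`, `x₂ ∈ U` and
`x₂ ∈ D(Λ ^ α)`, where `Λ ^ α` is the power of the extension of `Λ` to `V'`. -/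
def waveDomain (hL : IsAdmissible L) (α : ℝ) : Submodule ℝ (H hL) :=
  (fracPow L (1 / 2)).domain.comap (H.fst hL) ⊓
    ((LinearMap.range (emb hL).toLinearMap).comap (H.snd hL) ⊓
      (fracPow (extOp hL) α).domain.comap (H.snd hL))

/-- The first component of an element of the domain, in `V`. -/
def domFst (hL : IsAdmissible L) (α : ℝ) : waveDomain hL α →ₗ[ℝ] V hL :=
  LinearMap.codRestrict (fracPow L (1 / 2)).domain (H.fst hL ∘ₗ (waveDomain hL α).subtype)
    fun x => x.2.1

/-- The second component of an element of the domain, in `U`. -/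
def domSnd (hL : IsAdmissible L) (α : ℝ) : waveDomain hL α →ₗ[ℝ] U :=
  (LinearEquiv.ofInjective (emb hL).toLinearMap (emb_injective hL)).symm.toLinearMap ∘ₗ
    LinearMap.codRestrict (LinearMap.range (emb hL).toLinearMap)
      (H.snd hL ∘ₗ (waveDomain hL α).subtype) fun x => x.2.2.1

/-- `Λ ^ α x₂` for an element `(x₁, x₂)` of the domain. -/
def domPow (hL : IsAdmissible L) (α : ℝ) : waveDomain hL α →ₗ[ℝ] DualV hL :=
  (fracPow (extOp hL) α).toFun ∘ₗ
    LinearMap.codRestrict (fracPow (extOp hL) α).domain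
      (H.snd hL ∘ₗ (waveDomain hL α).subtype) fun x => x.2.2.2

/-- The damped wave operator `𝒜 (x₁, x₂) = (x₂, - Λ x₁ - ρ Λ ^ α x₂)` in `H = U × V'`. -/
def waveOp (hL : IsAdmissible L) (α ρ : ℝ) : H hL →ₗ.[ℝ] H hL where
  domain := waveDomain hL α
  toFun := (H.equiv hL).symm.toLinearEquiv.toLinearMap ∘ₗ
    (domSnd hL α).prod (-(lapl hL ∘ₗ domFst hL α) - ρ • domPow hL α)

end Spaces

/-! ### Cylindrical Wiener processes and stochastic integrals of deterministic integrands -/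

section Stochastic

variable {U E Ω : Type*} [NormedAddCommGroup U] [InnerProductSpace ℝ U] [CompleteSpace U]
  [NormedAddCommGroup E] [NormedSpace ℝ E] [MeasurableSpace Ω]

/-- `W` is a cylindrical Wiener process on `U`, `W t u` being the real random variable `⟪W_t, u⟫`:
a centred Gaussian family with covariance `E[⟪W_s, u⟫ ⟪W_t, v⟫] = min s t ⟪u, v⟫` for which
every `⟪W, u⟫` has almost surely continuous paths. -/
structure IsCylindricalWiener (W : ℝ≥0 → U → Ω → ℝ) (P : Measure Ω) : Prop where
  gaussian : IsGaussianProcess (fun p : ℝ≥0 × U => W p.1 p.2) P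
  mean : ∀ t u, ∫ ω, W t u ω ∂P = 0
  covariance : ∀ s t u v, ∫ ω, W s u ω * W t v ω ∂P = min (s : ℝ) t * ⟪u, v⟫_ℝ
  continuous : ∀ u, ∀ᵐ ω ∂P, Continuous fun t => W t u ω

/-- Deterministic elementary integrands on `(0, t]`:
`s ↦ ∑ i, 1_{(a i, b i]}(s) ⟪u i, ·⟫ y i`, a step function whose values are
operators of finite rank from `U` to `E`. -/
structure Elementary (U E : Type*) (t : ℝ≥0) where
  n : ℕ
  a : Fin n → ℝ≥0
  b : Fin n → ℝ≥0
  u : Fin n → U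
  y : Fin n → E
  a_le_b : ∀ i, a i ≤ b i
  b_le : ∀ i, b i ≤ t

/-- The operator-valued step function of an elementary integrand. -/
def Elementary.toFun {t : ℝ≥0} (f : Elementary U E t) (s : ℝ) : U →L[ℝ] E :=
  ∑ i, (Ioc (f.a i : ℝ) (f.b i)).indicator (fun _ => (innerSL ℝ (f.u i)).smulRight (f.y i)) s

/-- The integral `∑ i, (⟪W_{b i}, u i⟫ - ⟪W_{a i}, u i⟫) y i` of an elementary integrand. -/
def Elementary.integral {t : ℝ≥0} (f : Elementary U E t) (W : ℝ≥0 → U → Ω → ℝ) (ω : Ω) : E :=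
  ∑ i, (W (f.b i) (f.u i) ω - W (f.a i) (f.u i) ω) • f.y i

/-- `X` is the stochastic integral `∫_0^t Φ s dW_s`: it is the limit in `L²(Ω; E)` of the
integrals of elementary integrands that approximate `Φ` in `L²((0, t]; L₂(U, E))`. -/
def IsStochasticIntegral (W : ℝ≥0 → U → Ω → ℝ) (P : Measure Ω) (t : ℝ≥0) (Φ : ℝ → U →L[ℝ] E)
    (X : Ω → E) : Prop :=
  MemLp X 2 P ∧ ∃ f : ℕ → Elementary U E t,
    Tendsto (fun n => ∫⁻ s in Ioc (0 : ℝ) t, hsNorm ((f n).toFun s - Φ s) ^ 2) atTop (𝓝 0) ∧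
    Tendsto (fun n => eLpNorm (fun ω => (f n).integral W ω - X ω) 2 P) atTop (𝓝 0)

end Stochastic

end DampedWave

end

/-! Everything reduces to damped oscillators in the plane. Since `Λ⁻¹` is nuclear, hence compact,
and symmetric, `U` has an orthonormal basis `e i` of eigenvectors of `Λ`, with eigenvalues `μ i > 0`
and `∑ (μ i)⁻¹ < ∞` (`IsAdmissible.exists_eigenbasis`, `IsAdmissible.summable_inv`). The vectors
`√(μ i) • e i`, read in `V'`, form an orthonormal basis of `V'`. In these two bases `H` becomes a
Hilbert sum of planes, and the wave operator acts on the `i`-th plane by the matrix `[[0, √μ], [-√μ,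
-ρ μ ^ α]]` with `μ = μ i` (`coordEquiv_waveOp`).

The off-diagonal part of each matrix is skew and the damping is nonnegative, so every block is
dissipative and its exponential is a contraction. Contractions add up to a strongly continuous
semigroup on the Hilbert sum. Its generator is the maximal block diagonal operator, and this is the
closure of the wave operator because the domain contains every vector supported in one block
(`generates_conjFlow`). Conversely, for any semigroup generated by the closure, the coordinates of
orbits starting in the domain solve the linear equations of the blocks (`Generates.coord_eq`).

The vector `G (e i) = (0, e i)` lies in the `i`-th block and has squared norm `(μ i)⁻¹`, so `‖S t (G
(e i))‖ ^ 2 ≤ (μ i)⁻¹` for all `t ≥ 0`. Summation bounds the squared Hilbert-Schmidt norm by the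
trace of `Λ⁻¹`, uniformly in time. The weighted integral is then finite because `t ^ (-2 γ)` is
integrable at `0`.

For the stochastic integral, the same summable bound controls the tails of the strongly continuous
integrand, which lets elementary integrands approximate it uniformly in Hilbert-Schmidt norm. The
Itô isometry (`Elementary.isometry`) and the completeness of `L²` give the limit; the isometry also
gives uniqueness. -/

noncomputable section

namespace DampedWave

universe u

/-! ### Semigroups of dissipative bounded operators -/

section BoundedDissipative

variable {F : Type*} [NormedAddCommGroup F] [InnerProductSpace ℝ F]

/-- The group `t ↦ exp (t B)` generated by a bounded operator. -/
def expFlow (B : F →L[ℝ] F) (t : ℝ) : F →L[ℝ] F := NormedSpace.exp (t • B)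

lemma expFlow_zero (B : F →L[ℝ] F) : expFlow B 0 = 1 := by
  simp [expFlow, NormedSpace.exp_zero]

variable [CompleteSpace F]

lemma expFlow_add (B : F →L[ℝ] F) (s t : ℝ) :
    expFlow B (s + t) = expFlow B s * expFlow B t := by
  let : NormedAlgebra ℚ (F →L[ℝ] F) := NormedAlgebra.restrictScalars ℚ ℝ _
  rw [expFlow, add_smul]
  exact NormedSpace.exp_add_of_commute (((Commute.refl B).smul_left s).smul_right t)

lemma expFlow_neg_mul (B : F →L[ℝ] F) (t : ℝ) : expFlow B t * expFlow B (-t) = 1 := by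
  rw [← expFlow_add, add_neg_cancel, expFlow_zero]

lemma hasDerivAt_expFlow (B : F →L[ℝ] F) (t : ℝ) :
    HasDerivAt (expFlow B) (expFlow B t * B) t :=
  hasDerivAt_exp_smul_const B t

lemma hasDerivAt_expFlow_apply (B : F →L[ℝ] F) (z : F) (t : ℝ) :
    HasDerivAt (fun s => expFlow B s z) (expFlow B t (B z)) t := by
  simpa using (hasDerivAt_expFlow B t).clm_apply (hasDerivAt_const t z)

lemma hasDerivAt_expFlow_apply' (B : F →L[ℝ] F) (z : F) (t : ℝ) :
    HasDerivAt (fun s => expFlow B s z) (B (expFlow B t z)) t := by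
  have h : HasDerivAt (expFlow B) (B * expFlow B t) t := hasDerivAt_exp_smul_const' B t
  simpa using h.clm_apply (hasDerivAt_const t z)

/-- The semigroup of a dissipative operator is contractive. -/
lemma norm_expFlow_apply_le {B : F →L[ℝ] F} (hB : ∀ z, ⟪B z, z⟫_ℝ ≤ 0) {t : ℝ} (ht : 0 ≤ t)
    (z : F) : ‖expFlow B t z‖ ≤ ‖z‖ := by
  have hd : ∀ s, HasDerivAt (fun s => ‖expFlow B s z‖ ^ 2)
      (2 * ⟪expFlow B s z, B (expFlow B s z)⟫_ℝ) s :=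
    fun s => (hasDerivAt_expFlow_apply' B z s).norm_sq
  have hanti : Antitone fun s => ‖expFlow B s z‖ ^ 2 := by
    refine antitone_of_deriv_nonpos (fun s => (hd s).differentiableAt) fun s => ?_
    rw [(hd s).deriv, real_inner_comm]
    linarith [hB (expFlow B s z)]
  have h := hanti ht
  simp only [expFlow_zero, one_apply_eq_self] at h
  exact (sq_le_sq₀ (norm_nonneg _) (norm_nonneg _)).1 h

/-- The orbit has derivative `exp (s B) (B z)`, of norm at most `‖B z‖` by contractivity. The bound
involves `‖B z‖` and not `‖B‖`, which is what survives a sum over blocks of unbounded norm. -/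
lemma norm_expFlow_sub_le {B : F →L[ℝ] F} (hB : ∀ z, ⟪B z, z⟫_ℝ ≤ 0) {t : ℝ} (ht : 0 ≤ t)
    (z : F) : ‖expFlow B t z - z‖ ≤ ‖B z‖ * t := by
  have h := norm_image_sub_le_of_norm_deriv_le_segment' (a := 0) (b := t) (C := ‖B z‖)
    (fun s _ => (hasDerivAt_expFlow_apply B z s).hasDerivWithinAt)
    (fun s hs => norm_expFlow_apply_le hB hs.1 _) t (right_mem_Icc.2 ht)
  simpa [expFlow_zero] using h

lemma tendsto_expFlow_slope (B : F →L[ℝ] F) (z : F) :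
    Tendsto (fun t : ℝ => t⁻¹ • (expFlow B t z - z)) (𝓝[>] 0) (𝓝 (B z)) := by
  have h := (hasDerivAt_expFlow_apply' B z 0).hasDerivWithinAt (s := Ioi 0)
  rw [hasDerivWithinAt_iff_tendsto_slope' (by simp)] at h
  simpa [slope_fun_def, expFlow_zero] using h

/-- Uniqueness for `u' = B u` with right derivatives. -/
lemma eq_expFlow_of_hasDerivWithinAt (B : F →L[ℝ] F) {u : ℝ → F} (hc : ContinuousOn u (Ici 0))
    (hd : ∀ t, 0 ≤ t → HasDerivWithinAt u (B (u t)) (Ici t) t) {t : ℝ} (ht : 0 ≤ t) :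
    u t = expFlow B t (u 0) := by
  have hE : ∀ s, HasDerivAt (fun s => expFlow B (-s)) (-(expFlow B (-s) * B)) s := fun s => by
    have h := (hasDerivAt_expFlow B (-s)).scomp s (hasDerivAt_neg s)
    rw [neg_one_smul] at h
    exact h
  -- The two terms of the product rule cancel, so `exp (-s B) (u s)` is constant.
  have hv : ∀ s ∈ Ico 0 t, HasDerivWithinAt (fun s => expFlow B (-s) (u s)) 0 (Ici s) s := by
    intro s hs
    have := (hE s).hasDerivWithinAt.clm_apply (hd s hs.1)
    simpa using this
  have hcE : Continuous fun s => expFlow B (-s) :=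
    continuous_iff_continuousAt.2 fun s => (hE s).continuousAt
  have h := constant_of_has_deriv_right_zero (a := 0) (b := t)
    (f := fun s => expFlow B (-s) (u s))
    (hcE.continuousOn.clm_apply (hc.mono Icc_subset_Ici_self)) hv t (right_mem_Icc.2 ht)
  have h' := congrArg (expFlow B t) h
  rw [← mul_apply_eq_comp, expFlow_neg_mul] at h'
  simpa [expFlow_zero] using h'

end BoundedDissipative

/-! ### Block diagonal semigroups on Hilbert sums -/

section Diagonal

variable {ι : Type*} {F : ι → Type*} [∀ i, NormedAddCommGroup (F i)]

lemma lp_two_norm_sq (x : lp F 2) : ‖x‖ ^ 2 = ∑' i, ‖x i‖ ^ 2 := by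
  have h := lp.norm_rpow_eq_tsum (p := 2) (by norm_num) x
  simpa using h

lemma lp_two_summable (x : lp F 2) : Summable fun i => ‖x i‖ ^ 2 := by
  have h := (lp.memℓp x).summable (by norm_num)
  simpa using h

/-- Dominated convergence in `ℓ²`. -/
lemma lp_two_tendsto_of_dominated {α : Type*} {l : Filter α} {f : α → lp F 2} {x : lp F 2}
    {g : ι → ℝ} (hg : Summable fun i => g i ^ 2) (hb : ∀ᶠ a in l, ∀ i, ‖f a i - x i‖ ≤ g i)
    (h : ∀ i, Tendsto (fun a => f a i) l (𝓝 (x i))) : Tendsto f l (𝓝 x) := by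
  rw [tendsto_iff_norm_sub_tendsto_zero]
  have h1 : Tendsto (fun a => ‖f a - x‖ ^ 2) l (𝓝 0) := by
    simp_rw [lp_two_norm_sq]
    have h2 := tendsto_tsum_of_dominated_convergence (𝓕 := l)
      (f := fun a i => ‖(f a - x) i‖ ^ 2) (g := fun _ => (0 : ℝ)) hg (fun i => ?_) ?_
    · simpa using h2
    · have := ((h i).sub_const (x i)).norm.pow 2
      simpa using this
    · filter_upwards [hb] with a ha i
      rw [norm_pow, norm_norm]
      exact pow_le_pow_left₀ (norm_nonneg _) (ha i) 2
  simpa using h1.sqrt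

variable [∀ i, InnerProductSpace ℝ (F i)]

/-- The operator on `ℓ²` which acts by the contraction `T i` on the `i`-th component. -/
def diagCLM (T : ∀ i, F i →L[ℝ] F i) (hT : ∀ i z, ‖T i z‖ ≤ ‖z‖) : lp F 2 →L[ℝ] lp F 2 :=
  LinearMap.mkContinuous
    { toFun := fun x => ⟨fun i => T i (x i), memℓp_gen <| by
        have h : Summable fun i => ‖T i (x i)‖ ^ 2 :=
          (lp_two_summable x).of_nonneg_of_le (fun _ => sq_nonneg _)
            fun i => pow_le_pow_left₀ (norm_nonneg _) (hT i _) 2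
        simpa using h⟩
      map_add' := fun x y => lp.ext <| funext fun i => map_add (T i) (x i) (y i)
      map_smul' := fun c x => lp.ext <| funext fun i => map_smul (T i) c (x i) } 1 fun x => by
      rw [one_mul]
      refine (sq_le_sq₀ (norm_nonneg _) (norm_nonneg _)).1 ?_
      rw [lp_two_norm_sq, lp_two_norm_sq]
      have h : ∀ i, ‖T i (x i)‖ ^ 2 ≤ ‖x i‖ ^ 2 :=
        fun i => pow_le_pow_left₀ (norm_nonneg _) (hT i _) 2
      exact Summable.tsum_le_tsum h
        ((lp_two_summable x).of_nonneg_of_le (fun _ => sq_nonneg _) h) (lp_two_summable x)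

@[simp]
lemma diagCLM_apply (T : ∀ i, F i →L[ℝ] F i) (hT : ∀ i z, ‖T i z‖ ≤ ‖z‖) (x : lp F 2) (i : ι) :
    diagCLM T hT x i = T i (x i) := rfl

variable {E : Type*} [NormedAddCommGroup E] [InnerProductSpace ℝ E]

lemma coord_ext (Φ : E ≃ₗᵢ[ℝ] lp F 2) {x y : E} (h : ∀ i, Φ x i = Φ y i) : x = y :=
  Φ.injective (lp.ext (funext h))

lemma continuous_coord (Φ : E ≃ₗᵢ[ℝ] lp F 2) (i : ι) : Continuous fun x => Φ x i :=
  (lp.evalCLM ℝ F 2 i).continuous.comp Φ.continuous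

lemma tendsto_of_coord_dominated (Φ : E ≃ₗᵢ[ℝ] lp F 2) {α : Type*} {l : Filter α} {f : α → E}
    {x : E} {g : ι → ℝ} (hg : Summable fun i => g i ^ 2)
    (hb : ∀ᶠ a in l, ∀ i, ‖Φ (f a) i - Φ x i‖ ≤ g i)
    (h : ∀ i, Tendsto (fun a => Φ (f a) i) l (𝓝 (Φ x i))) : Tendsto f l (𝓝 x) := by
  have := (Φ.symm.continuous.tendsto (Φ x)).comp (lp_two_tendsto_of_dominated hg hb h)
  simpa [Function.comp_def] using this

/-- An operator which acts block diagonally and whose domain contains all the blocks has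
the maximal block diagonal operator as its closure. -/
lemma mem_closure_graph_iff (Φ : E ≃ₗᵢ[ℝ] lp F 2) (B : ∀ i, F i →L[ℝ] F i)
    (A : E →ₗ.[ℝ] E) (hA : ∀ x : A.domain, ∀ i, Φ (A x) i = B i (Φ x i))
    (hdom : ∀ x : E, ∀ i, (∀ j, j ≠ i → Φ x j = 0) → x ∈ A.domain) (x y : E) :
    (x, y) ∈ A.graph.topologicalClosure ↔ ∀ i, Φ y i = B i (Φ x i) := by
  classical
  constructor
  · intro h i
    -- Each coordinate relation is a closed condition on pairs, because a single block is bounded;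
    -- it therefore passes from the graph to its closure.
    have hcl : IsClosed {p : E × E | Φ p.2 i = B i (Φ p.1 i)} :=
      isClosed_eq ((continuous_coord Φ i).comp continuous_snd)
        ((B i).continuous.comp ((continuous_coord Φ i).comp continuous_fst))
    refine closure_minimal (t := {p : E × E | Φ p.2 i = B i (Φ p.1 i)}) ?_ hcl h
    rintro ⟨a, b⟩ hab
    obtain ⟨c, rfl, rfl⟩ := (LinearPMap.mem_graph_iff A).1 hab
    exact hA c i
  · intro h
    have hsum : ∀ w : E, HasSum (fun i => Φ.symm (lp.single 2 i (Φ w i))) w := by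
      intro w
      have := (lp.hasSum_single (p := 2) (by norm_num) (Φ w)).mapL
        (Φ.symm.toContinuousLinearEquiv : lp F 2 →L[ℝ] E)
      simpa using this
    -- The restriction of `(x, y)` to one block lies in the graph itself, and finite sums of such
    -- pairs converge to `(x, y)`.
    have hg : ∀ i, (Φ.symm (lp.single 2 i (Φ x i)), Φ.symm (lp.single 2 i (Φ y i)))
        ∈ A.graph := by
      intro i
      have hd := hdom (Φ.symm (lp.single 2 i (Φ x i))) i fun j hj => by
        simp [lp.single_apply, hj]
      refine (LinearPMap.mem_graph_iff A).2 ⟨⟨_, hd⟩, rfl, ?_⟩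
      refine coord_ext Φ fun j => ?_
      rw [hA]
      by_cases hj : j = i
      · subst hj
        simp [h]
      · simp [lp.single_apply, hj]
    have hxy := (hsum x).prodMk (hsum y)
    exact mem_closure_of_tendsto hxy (Eventually.of_forall fun s => Submodule.sum_mem _
      fun i _ => hg i)

/-- Orbits of points in the domain have the right derivative `S t (A x)`, and stay in the domain
of the closure. -/
lemma Generates.orbit {A : E →ₗ.[ℝ] E} {S : ℝ → E →L[ℝ] E} (hS : Generates A S) {x y : E}
    (hxy : (x, y) ∈ A.graph.topologicalClosure) {t : ℝ} (ht : 0 ≤ t) :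
    (S t x, S t y) ∈ A.graph.topologicalClosure ∧
      HasDerivWithinAt (fun s => S s x) (S t y) (Ici t) t := by
  have h := ((S t).continuous.tendsto y).comp ((hS.2 x y).1 hxy)
  -- The image under `S t` of the difference quotient at time `0` is the difference quotient of the
  -- orbit at time `t`. With the two factors of `S (t + h)` exchanged, it is also the quotient at
  -- time `0` for the starting point `S t x`.
  have e : ∀ h > 0, S t (h⁻¹ • (S h x - x)) = h⁻¹ • (S (t + h) x - S t x) := by
    intro h hh
    rw [hS.1.add t h ht hh.le, map_smul, map_sub]
    rfl
  constructor
  · refine (hS.2 _ _).2 (h.congr' ?_)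
    filter_upwards [self_mem_nhdsWithin] with r hr
    have hr : 0 < r := hr
    rw [Function.comp_apply, e r hr, add_comm t r, hS.1.add r t hr.le ht]
    rfl
  · rw [← hasDerivWithinAt_Ioi_iff_Ici, hasDerivWithinAt_iff_tendsto_slope' (by simp)]
    have hm : Tendsto (fun s : ℝ => s - t) (𝓝[>] t) (𝓝[>] 0) := by
      refine tendsto_nhdsWithin_iff.2 ⟨?_, ?_⟩
      · have : Tendsto (fun s : ℝ => s - t) (𝓝 t) (𝓝 (t - t)) :=
          (continuous_id.sub continuous_const).tendsto t
        rw [sub_self] at this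
        exact this.mono_left nhdsWithin_le_nhds
      · filter_upwards [self_mem_nhdsWithin] with s hs
        exact sub_pos.2 (mem_Ioi.1 hs)
    refine (h.comp hm).congr' ?_
    filter_upwards [self_mem_nhdsWithin] with s hs
    have := e (s - t) (sub_pos.2 (mem_Ioi.1 hs))
    simp only [Function.comp_apply]
    rw [this, add_sub_cancel, slope_def_module]

variable [∀ i, CompleteSpace (F i)]

/-- The semigroup which is `exp (t B i)` on the `i`-th component (for `t ≥ 0`). -/
def diagFlow (B : ∀ i, F i →L[ℝ] F i) (hB : ∀ i z, ⟪B i z, z⟫_ℝ ≤ 0) (t : ℝ) :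
    lp F 2 →L[ℝ] lp F 2 :=
  -- For negative `t` the exponentials need not be contractions; truncation at `0` puts the identity
  -- there.
  diagCLM (fun i => expFlow (B i) (max t 0)) fun i z =>
    norm_expFlow_apply_le (hB i) (le_max_right _ _) z

lemma diagFlow_apply (B : ∀ i, F i →L[ℝ] F i) (hB : ∀ i z, ⟪B i z, z⟫_ℝ ≤ 0) {t : ℝ}
    (ht : 0 ≤ t) (x : lp F 2) (i : ι) : diagFlow B hB t x i = expFlow (B i) t (x i) := by
  rw [diagFlow, diagCLM_apply, max_eq_left ht]

/-- The semigroup `diagFlow` transported to a space which is isometric to the Hilbert sum. -/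
def conjFlow (Φ : E ≃ₗᵢ[ℝ] lp F 2) (B : ∀ i, F i →L[ℝ] F i) (hB : ∀ i z, ⟪B i z, z⟫_ℝ ≤ 0)
    (t : ℝ) : E →L[ℝ] E :=
  (Φ.symm.toContinuousLinearEquiv : lp F 2 →L[ℝ] E).comp
    ((diagFlow B hB t).comp (Φ.toContinuousLinearEquiv : E →L[ℝ] lp F 2))

lemma conjFlow_coord (Φ : E ≃ₗᵢ[ℝ] lp F 2) (B : ∀ i, F i →L[ℝ] F i)
    (hB : ∀ i z, ⟪B i z, z⟫_ℝ ≤ 0) {t : ℝ} (ht : 0 ≤ t) (x : E) (i : ι) :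
    Φ (conjFlow Φ B hB t x) i = expFlow (B i) t (Φ x i) := by
  rw [← diagFlow_apply B hB ht]
  simp [conjFlow]

/-- The semigroup laws hold block by block. Strong continuity is dominated convergence in `ℓ²`:
contractivity bounds the difference of two values of an orbit by `2 ‖Φ x i‖` in the `i`-th block. -/
lemma isC0Semigroup_conjFlow (Φ : E ≃ₗᵢ[ℝ] lp F 2) (B : ∀ i, F i →L[ℝ] F i)
    (hB : ∀ i z, ⟪B i z, z⟫_ℝ ≤ 0) : IsC0Semigroup (conjFlow Φ B hB) where
  zero := by
    ext x
    refine coord_ext Φ fun i => ?_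
    rw [conjFlow_coord Φ B hB le_rfl, expFlow_zero]
    rfl
  add s t hs ht := by
    ext x
    refine coord_ext Φ fun i => ?_
    rw [ContinuousLinearMap.comp_apply, conjFlow_coord Φ B hB (add_nonneg hs ht),
      conjFlow_coord Φ B hB hs, conjFlow_coord Φ B hB ht, expFlow_add]
    rfl
  continuousOn x := by
    intro t ht
    refine tendsto_of_coord_dominated Φ (g := fun i => 2 * ‖Φ x i‖) ?_ ?_ fun i => ?_
    · simpa [mul_pow] using (lp_two_summable (Φ x)).mul_left 4 |>.congr fun i => by ring
    · filter_upwards [self_mem_nhdsWithin] with s hs i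
      rw [conjFlow_coord Φ B hB hs, conjFlow_coord Φ B hB ht, two_mul]
      exact (norm_sub_le _ _).trans (add_le_add (norm_expFlow_apply_le (hB i) hs _)
        (norm_expFlow_apply_le (hB i) ht _))
    · rw [conjFlow_coord Φ B hB ht]
      refine Tendsto.congr' ?_
        ((hasDerivAt_expFlow_apply (B i) (Φ x i) t).continuousAt.mono_left nhdsWithin_le_nhds)
      filter_upwards [self_mem_nhdsWithin] with s hs
      rw [conjFlow_coord Φ B hB hs]

/-- The generator of the block diagonal semigroup is the maximal block diagonal operator. -/
lemma tendsto_conjFlow_slope_iff (Φ : E ≃ₗᵢ[ℝ] lp F 2) (B : ∀ i, F i →L[ℝ] F i)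
    (hB : ∀ i z, ⟪B i z, z⟫_ℝ ≤ 0) (x y : E) :
    Tendsto (fun t : ℝ => t⁻¹ • (conjFlow Φ B hB t x - x)) (𝓝[>] 0) (𝓝 y) ↔
      ∀ i, Φ y i = B i (Φ x i) := by
  have key : ∀ i, ∀ t > 0, Φ (t⁻¹ • (conjFlow Φ B hB t x - x)) i
      = t⁻¹ • (expFlow (B i) t (Φ x i) - Φ x i) := by
    intro i t ht
    rw [← conjFlow_coord Φ B hB ht.le, map_smul, map_sub]
    rfl
  have hlim : ∀ i, Tendsto (fun t : ℝ => Φ (t⁻¹ • (conjFlow Φ B hB t x - x)) i) (𝓝[>] 0)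
      (𝓝 (B i (Φ x i))) := by
    intro i
    refine Tendsto.congr' ?_ (tendsto_expFlow_slope (B i) (Φ x i))
    filter_upwards [self_mem_nhdsWithin] with t ht
    rw [key i t ht]
  constructor
  · intro h i
    exact tendsto_nhds_unique (((continuous_coord Φ i).tendsto y).comp h) (hlim i)
  · intro h
    -- The quotient in block `i` is at most `‖B i (Φ x i)‖ = ‖Φ y i‖` by `norm_expFlow_sub_le`, and
    -- its limit `Φ y i` accounts for the second summand.
    refine tendsto_of_coord_dominated Φ (g := fun i => 2 * ‖Φ y i‖) ?_ ?_ fun i => ?_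
    · simpa [mul_pow] using (lp_two_summable (Φ y)).mul_left 4 |>.congr fun i => by ring
    · filter_upwards [self_mem_nhdsWithin] with t ht i
      have ht : 0 < t := ht
      rw [key i t ht, two_mul]
      refine (norm_sub_le _ _).trans (add_le_add ?_ le_rfl)
      rw [norm_smul, norm_inv, Real.norm_of_nonneg ht.le, inv_mul_le_iff₀ ht, h i, mul_comm]
      exact norm_expFlow_sub_le (hB i) ht.le _
    · rw [h i]
      exact hlim i

/-- The closure of the graph of `A` and the graph of the generator are the same set, `{(x, y) | ∀ i,
Φ y i = B i (Φ x i)}`. -/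
theorem generates_conjFlow (Φ : E ≃ₗᵢ[ℝ] lp F 2) (B : ∀ i, F i →L[ℝ] F i)
    (hB : ∀ i z, ⟪B i z, z⟫_ℝ ≤ 0) (A : E →ₗ.[ℝ] E)
    (hA : ∀ x : A.domain, ∀ i, Φ (A x) i = B i (Φ x i))
    (hdom : ∀ x : E, ∀ i, (∀ j, j ≠ i → Φ x j = 0) → x ∈ A.domain) :
    Generates A (conjFlow Φ B hB) :=
  ⟨isC0Semigroup_conjFlow Φ B hB, fun x y => by
    rw [mem_closure_graph_iff Φ B A hA hdom, tendsto_conjFlow_slope_iff]⟩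

/-- A semigroup generated by a block diagonal operator acts by `exp (t B i)` on the blocks. -/
theorem Generates.coord_eq (Φ : E ≃ₗᵢ[ℝ] lp F 2) (B : ∀ i, F i →L[ℝ] F i) (A : E →ₗ.[ℝ] E)
    (hA : ∀ x : A.domain, ∀ i, Φ (A x) i = B i (Φ x i))
    (hdom : ∀ x : E, ∀ i, (∀ j, j ≠ i → Φ x j = 0) → x ∈ A.domain)
    {S : ℝ → E →L[ℝ] E} (hS : Generates A S) {t : ℝ} (ht : 0 ≤ t) {x : E} (hx : x ∈ A.domain)
    (i : ι) : Φ (S t x) i = expFlow (B i) t (Φ x i) := by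
  have hxy : (x, A ⟨x, hx⟩) ∈ A.graph.topologicalClosure :=
    Submodule.le_topologicalClosure _ ((LinearPMap.mem_graph_iff A).2 ⟨⟨x, hx⟩, rfl, rfl⟩)
  have h := eq_expFlow_of_hasDerivWithinAt (B i) (u := fun s => Φ (S s x) i)
    ((continuous_coord Φ i).comp_continuousOn (hS.1.continuousOn x)) (fun s hs => ?_) ht
  · simpa [hS.1.zero] using h
  -- The orbit stays in the domain of the closure, which is block diagonal, so the `i`-th coordinate
  -- of its right derivative is `B i` applied to its own `i`-th coordinate.
  · obtain ⟨h1, h2⟩ := hS.orbit hxy hs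
    rw [← (mem_closure_graph_iff Φ B A hA hdom _ _).1 h1 i]
    exact ((lp.evalCLM ℝ F 2 i).comp
      (Φ.toContinuousLinearEquiv : E →L[ℝ] lp F 2)).hasFDerivAt.comp_hasDerivWithinAt s h2

end Diagonal

/-! ### Powers on eigenvectors -/

section PowEigenvector

variable {E : Type*} [NormedAddCommGroup E] [InnerProductSpace ℝ E] [CompleteSpace E]
  {L : E →ₗ.[ℝ] E} {m : ℝ} {x : E}

lemma eigenproj_eq_zero {k : ℝ} (h : ∀ y ∈ eigenspace L k, ⟪y, x⟫_ℝ = 0) :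
    eigenproj L k x = 0 := by
  refine (Submodule.starProjection_apply_eq_zero_iff _).2 ?_
  rw [Submodule.orthogonal_closure]
  exact (Submodule.mem_orthogonal _ _).2 h

/-- Only one term of the spectral series survives. Orthogonality to the other eigenspaces is a
hypothesis, so that the result serves both `Λ` and its extension to `V'`. -/
lemma hasSum_fracPow_eigenvector (s : ℝ) (hx : x ∈ eigenspace L m)
    (h0 : ∀ k, k ≠ m → eigenproj L k x = 0) :
    HasSum (fun k : ℝ => k ^ s • eigenproj L k x) (m ^ s • x) := by
  have h := hasSum_single (f := fun k : ℝ => k ^ s • eigenproj L k x) m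
    fun k hk => by rw [h0 k hk, smul_zero]
  rwa [eigenproj_of_mem hx] at h

/-- The spectral projections are symmetric, so they can be moved onto the eigenvector `x` term by
term. -/
lemma inner_fracPow_eigenvector {s : ℝ} (hx : x ∈ eigenspace L m)
    (h0 : ∀ k, k ≠ m → eigenproj L k x = 0) (w : (fracPow L s).domain) :
    ⟪x, fracPow L s w⟫_ℝ = m ^ s * ⟪x, (w : E)⟫_ℝ := by
  have hw : HasSum (fun k : ℝ => k ^ s • eigenproj L k (w : E)) (fracPow L s w) :=
    Summable.hasSum w.2
  have h1 := hw.mapL (innerSL ℝ x)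
  have h2 := (hasSum_fracPow_eigenvector s hx h0).mapL (innerSL ℝ (w : E))
  simp only [innerSL_apply_apply, real_inner_smul_right] at h1 h2
  rw [real_inner_comm x] at h2
  refine h1.unique (h2.congr_fun ?_)
  intro k
  rw [← eigenproj_inner, real_inner_comm]

end PowEigenvector

/-! ### Orthonormal bases of eigenvectors -/

section Eigenbasis

variable {U : Type*} [NormedAddCommGroup U] [InnerProductSpace ℝ U] [CompleteSpace U]
  {L : U →ₗ.[ℝ] U}

lemma IsAdmissible.eigenproj_of_ne (hL : IsAdmissible L) {m k : ℝ} {x : U}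
    (hx : x ∈ eigenspace L m) (hk : k ≠ m) : eigenproj L k x = 0 :=
  eigenproj_eq_zero fun _ hy => hL.ortho hk hy hx

/-- Orthonormal bases of the closed, mutually orthogonal eigenspaces are put together; the union is
total by `IsAdmissible.complete`. -/
lemma IsAdmissible.exists_eigenbasis {U : Type u} [NormedAddCommGroup U] [InnerProductSpace ℝ U]
    [CompleteSpace U] {L : U →ₗ.[ℝ] U} (hL : IsAdmissible L) :
    ∃ (ι : Type u) (e : HilbertBasis ι ℝ U) (μ : ι → ℝ), ∀ i, e i ∈ eigenspace L (μ i) := by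
  have hc : ∀ m, CompleteSpace (eigenspace L m) := fun m => by
    rw [← hL.closure_eigenspace m]
    infer_instance
  choose w b hb using fun m => exists_hilbertBasis ℝ (eigenspace L m)
  have ho := hL.orthogonalFamily.orthonormal_sigma_orthonormal fun m => (b m).orthonormal
  refine ⟨Σ m, w m, HilbertBasis.mkOfOrthogonalEqBot ho ?_, fun a => a.1, fun a => ?_⟩
  · refine (Submodule.eq_bot_iff _).2 fun x hx => hL.complete fun m y hy => ?_
    have hz : ∀ i, ⟪((b m i : eigenspace L m) : U), x⟫_ℝ = 0 := fun i =>
      (Submodule.mem_orthogonal _ _).1 hx _ (Submodule.subset_span ⟨⟨m, i⟩, rfl⟩)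
    have h1 := ((b m).hasSum_repr ⟨y, hy⟩).mapL
      ((innerSL ℝ x).comp (eigenspace L m).subtypeL)
    have h2 : ∀ i, ((innerSL ℝ x).comp (eigenspace L m).subtypeL)
        ((b m).repr ⟨y, hy⟩ i • b m i) = 0 := fun i => by
      have h := hz i
      rw [real_inner_comm] at h
      simp [h]
    simp only [h2] at h1
    have h3 := h1.unique hasSum_zero
    rw [real_inner_comm]
    exact h3
  · rw [HilbertBasis.coe_mkOfOrthogonalEqBot]
    exact (b a.1 a.2).2

variable {ι : Type*} {e : HilbertBasis ι ℝ U} {μ : ι → ℝ}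

lemma hilbertBasis_ext {E : Type*} [NormedAddCommGroup E] [InnerProductSpace ℝ E]
    (b : HilbertBasis ι ℝ E) {x y : E} (h : ∀ i, ⟪b i, x⟫_ℝ = ⟪b i, y⟫_ℝ) : x = y := by
  refine b.repr.injective (lp.ext (funext fun i => ?_))
  rw [b.repr_apply_apply, b.repr_apply_apply, h]

lemma IsAdmissible.eigenvalue_pos (hL : IsAdmissible L) (he : ∀ i, e i ∈ eigenspace L (μ i))
    (i : ι) : 0 < μ i := by
  by_contra h
  exact e.orthonormal.ne_zero i (hL.pos (he i) (not_lt.1 h))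

/-- The trace of the inverse is finite. -/
lemma IsAdmissible.summable_inv (hL : IsAdmissible L) (he : ∀ i, e i ∈ eigenspace L (μ i)) :
    Summable fun i => (μ i)⁻¹ := by
  obtain ⟨K, hK, a, b, hab, hKab⟩ := hL.inverse
  have hKe : ∀ i, K (e i) = (μ i)⁻¹ • e i := fun i => by
    obtain ⟨hd, h⟩ := he i
    have h1 := hK.1 ⟨e i, hd⟩
    rw [h, map_smul] at h1
    rw [eq_inv_smul_iff₀ (hL.eigenvalue_pos he i).ne']
    exact h1
  -- The number `(μ i)⁻¹ = ⟪e i, K (e i)⟫` is expanded through the nuclear representation of `K`.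
  have hs : ∀ i, HasSum (fun n => ⟪a n, e i⟫_ℝ * ⟪e i, b n⟫_ℝ) (μ i)⁻¹ := fun i => by
    have h1 := (hKab (e i)).mapL (innerSL ℝ (e i))
    simpa [hKe, real_inner_smul_right, e.orthonormal.norm_eq_one] using h1
  refine summable_of_sum_le (c := ∑' n, ‖a n‖ * ‖b n‖)
    (fun i => inv_nonneg.2 (hL.eigenvalue_pos he i).le) fun s => ?_
  refine hasSum_le (fun n => ?_) (hasSum_sum fun i _ => hs i) hab.hasSum
  -- For fixed `n`, the Cauchy-Schwarz and Bessel inequalities bound the sum over `i` by `‖a n‖ * ‖b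
  -- n‖`, independently of the finite set `s`.
  have bessel : ∀ y : U, ∑ i ∈ s, ⟪e i, y⟫_ℝ ^ 2 ≤ ‖y‖ ^ 2 := fun y => by
    simpa using e.orthonormal.sum_inner_products_le y (s := s)
  calc ∑ i ∈ s, ⟪a n, e i⟫_ℝ * ⟪e i, b n⟫_ℝ
      = ∑ i ∈ s, ⟪e i, a n⟫_ℝ * ⟪e i, b n⟫_ℝ := by
        simp only [real_inner_comm (a n)]
    _ ≤ √(∑ i ∈ s, ⟪e i, a n⟫_ℝ ^ 2) * √(∑ i ∈ s, ⟪e i, b n⟫_ℝ ^ 2) :=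
        Real.sum_mul_le_sqrt_mul_sqrt _ _ _
    _ ≤ √(‖a n‖ ^ 2) * √(‖b n‖ ^ 2) := by
        gcongr <;> exact bessel _
    _ = ‖a n‖ * ‖b n‖ := by
        rw [Real.sqrt_sq (norm_nonneg _), Real.sqrt_sq (norm_nonneg _)]

end Eigenbasis

/-! ### Coordinates in `V'` and in `H` -/

section Coordinates

variable {U : Type*} [NormedAddCommGroup U] [InnerProductSpace ℝ U] [CompleteSpace U]
  {L : U →ₗ.[ℝ] U}

/-- `Λ : V → V'` is the Riesz isomorphism of `V`, through which the inner product of `V'` is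
defined. -/
lemma inner_lapl_left (hL : IsAdmissible L) (v : V hL) (g : DualV hL) :
    ⟪lapl hL v, g⟫_ℝ = DualV.equiv hL g v := by
  have h : (InnerProductSpace.toDual ℝ (V hL)).symm (lapl hL v) = v :=
    (InnerProductSpace.toDual ℝ (V hL)).symm_apply_apply v
  change ⟪(InnerProductSpace.toDual ℝ (V hL)).symm (lapl hL v),
    (InnerProductSpace.toDual ℝ (V hL)).symm g⟫_ℝ = _
  rw [h, real_inner_comm]
  exact InnerProductSpace.toDual_symm_apply

lemma inner_lapl_emb (hL : IsAdmissible L) (v : V hL) (u : U) :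
    ⟪lapl hL v, emb hL u⟫_ℝ = ⟪V.val hL v, u⟫_ℝ := by
  rw [inner_lapl_left, emb_apply, real_inner_comm]
  rfl

lemma exists_lapl_eq (hL : IsAdmissible L) (g : DualV hL) : ∃ v, lapl hL v = g :=
  ⟨(InnerProductSpace.toDual ℝ (V hL)).symm g,
    (InnerProductSpace.toDual ℝ (V hL)).apply_symm_apply g⟩

lemma mem_eigenspace_extOp (hL : IsAdmissible L) {m : ℝ} {y : DualV hL} :
    y ∈ eigenspace (extOp hL) m ↔ ∃ v : V hL, embV hL v = y ∧ lapl hL v = m • y := by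
  have key : ∀ (v : V hL) (h : embV hL v ∈ (extOp hL).domain),
      extOp hL ⟨embV hL v, h⟩ = lapl hL v := fun v h => by
    change lapl hL ((LinearEquiv.ofInjective (embV hL) (embV_injective hL)).symm
      ⟨embV hL v, h⟩) = _
    congr 1
    exact (LinearEquiv.symm_apply_eq _).2 rfl
  constructor
  · rintro ⟨⟨v, rfl⟩, h⟩
    exact ⟨v, rfl, (key v _).symm.trans h⟩
  · rintro ⟨v, rfl, h⟩
    exact ⟨⟨v, rfl⟩, (key v _).trans h⟩

/-- The extended operator is symmetric: by `inner_lapl_emb`, `⟪Λ v, w⟫` and `⟪v, Λ w⟫` in `V'` both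
equal `⟪v, w⟫` in `U`. -/
lemma extOp_ortho (hL : IsAdmissible L) {m k : ℝ} (hmk : m ≠ k) {x y : DualV hL}
    (hx : x ∈ eigenspace (extOp hL) m) (hy : y ∈ eigenspace (extOp hL) k) : ⟪x, y⟫_ℝ = 0 := by
  obtain ⟨v, rfl, hv⟩ := (mem_eigenspace_extOp hL).1 hx
  obtain ⟨w, rfl, hw⟩ := (mem_eigenspace_extOp hL).1 hy
  have h1 : ⟪lapl hL v, embV hL w⟫_ℝ = ⟪V.val hL v, V.val hL w⟫_ℝ := inner_lapl_emb hL v _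
  have h2 : ⟪lapl hL w, embV hL v⟫_ℝ = ⟪V.val hL w, V.val hL v⟫_ℝ := inner_lapl_emb hL w _
  rw [hv, real_inner_smul_left] at h1
  rw [hw, real_inner_smul_left, real_inner_comm, real_inner_comm (V.val hL v)] at h2
  have h3 : (m - k) * ⟪embV hL v, embV hL w⟫_ℝ = 0 := by
    rw [sub_mul, h1, h2, sub_self]
  exact (mul_eq_zero.1 h3).resolve_left (sub_ne_zero.2 hmk)

lemma IsAdmissible.mem_fracPow_domain (hL : IsAdmissible L) {m : ℝ} {x : U}
    (hx : x ∈ eigenspace L m) (s : ℝ) : x ∈ (fracPow L s).domain :=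
  (hasSum_fracPow_eigenvector s hx fun _ hk => hL.eigenproj_of_ne hx hk).summable

/-- An element of the domain of `Λ ^ (1/2)`, as an element of `V`. -/
def V.mk (hL : IsAdmissible L) (x : U) (h : x ∈ (fracPow L (1 / 2)).domain) : V hL := ⟨x, h⟩

/-- The extension agrees with `Λ` on eigenvectors: one factor `m ^ (1/2)` comes from `Λ ^ (1/2) x`,
the other from moving `Λ ^ (1/2)` from the test vector onto `x`. -/
lemma lapl_eigenvector (hL : IsAdmissible L) {m : ℝ} {x : U} (hx : x ∈ eigenspace L m)
    (h : x ∈ (fracPow L (1 / 2)).domain) : lapl hL (V.mk hL x h) = m • emb hL x := by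
  rcases le_or_gt m 0 with hm | hm
  · obtain rfl := hL.pos hx hm
    rw [map_zero, smul_zero]
    exact map_zero (lapl hL)
  have h0 : ∀ k, k ≠ m → eigenproj L k x = 0 := fun _ hk => hL.eigenproj_of_ne hx hk
  have hhalf : V.half hL (V.mk hL x h) = m ^ (1 / 2 : ℝ) • x :=
    (hasSum_fracPow_eigenvector (1 / 2) hx h0).tsum_eq
  refine (DualV.equiv hL).injective (ContinuousLinearMap.ext fun w => ?_)
  rw [lapl_apply, V.inner_def, hhalf, map_smul, smul_apply, emb_apply,
    real_inner_smul_left, smul_eq_mul]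
  have := inner_fracPow_eigenvector hx h0 (s := 1 / 2) w
  change ⟪x, V.half hL w⟫_ℝ = m ^ (1 / 2 : ℝ) * ⟪x, V.incl hL w⟫_ℝ at this
  rw [this, ← mul_assoc, ← Real.rpow_add hm]
  norm_num

lemma emb_mem_eigenspace (hL : IsAdmissible L) {m : ℝ} {x : U} (hx : x ∈ eigenspace L m) :
    emb hL x ∈ eigenspace (extOp hL) m :=
  (mem_eigenspace_extOp hL).2
    ⟨V.mk hL x (hL.mem_fracPow_domain hx _), rfl, lapl_eigenvector hL hx _⟩

variable {ι : Type*} {e : HilbertBasis ι ℝ U} {μ : ι → ℝ}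

/-- From `Λ x = m x` and `inner_lapl_emb`. This is the source of the weights `(μ i)⁻¹` in the final
bound. -/
lemma inner_emb_emb (hL : IsAdmissible L) {m : ℝ} (hm : m ≠ 0) {x : U}
    (hx : x ∈ eigenspace L m) (u : U) : ⟪emb hL x, emb hL u⟫_ℝ = m⁻¹ * ⟪x, u⟫_ℝ := by
  have h := inner_lapl_emb hL (V.mk hL x (hL.mem_fracPow_domain hx _)) u
  rw [lapl_eigenvector hL hx, real_inner_smul_left] at h
  rw [eq_inv_mul_iff_mul_eq₀ hm]
  exact h

lemma orthonormal_emb (hL : IsAdmissible L) (he : ∀ i, e i ∈ eigenspace L (μ i)) :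
    Orthonormal ℝ fun i => √(μ i) • emb hL (e i) := by
  classical
  rw [orthonormal_iff_ite]
  intro i j
  have hp := hL.eigenvalue_pos he i
  rw [real_inner_smul_left, real_inner_smul_right, inner_emb_emb hL hp.ne' (he i),
    orthonormal_iff_ite.1 e.orthonormal i j]
  split_ifs with h
  · subst h
    rw [mul_one, ← mul_assoc, Real.mul_self_sqrt hp.le, mul_inv_cancel₀ hp.ne']
  · simp

/-- The orthonormal basis of `V'` which corresponds to a basis of eigenvectors. -/
def dualBasis (hL : IsAdmissible L) (he : ∀ i, e i ∈ eigenspace L (μ i)) :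
    HilbertBasis ι ℝ (DualV hL) :=
  HilbertBasis.mkOfOrthogonalEqBot (orthonormal_emb hL he) <| by
    refine (Submodule.eq_bot_iff _).2 fun g hg => ?_
    obtain ⟨v, rfl⟩ := exists_lapl_eq hL g
    -- A functional `Λ v` orthogonal to all the basis vectors forces all the coefficients of `v` in
    -- `U` to vanish.
    have hv : V.val hL v = 0 := by
      refine hilbertBasis_ext e fun i => ?_
      have h := (Submodule.mem_orthogonal _ _).1 hg _ (Submodule.subset_span ⟨i, rfl⟩)
      rw [real_inner_smul_left, real_inner_comm, inner_lapl_emb, real_inner_comm] at h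
      rw [inner_zero_right]
      exact (mul_eq_zero.1 h).resolve_left (Real.sqrt_pos.2 (hL.eigenvalue_pos he i)).ne'
    have : v = 0 := Subtype.ext hv
    rw [this, map_zero]

lemma dualBasis_apply (hL : IsAdmissible L) (he : ∀ i, e i ∈ eigenspace L (μ i)) (i : ι) :
    dualBasis hL he i = √(μ i) • emb hL (e i) := by
  rw [dualBasis, HilbertBasis.coe_mkOfOrthogonalEqBot]

/-- This yields the entry `√μ` in the first row of the block; `inner_dualBasis_lapl` and
`inner_dualBasis_fracPow` yield the second row. -/
lemma inner_dualBasis_emb (hL : IsAdmissible L) (he : ∀ i, e i ∈ eigenspace L (μ i)) (i : ι)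
    (u : U) : √(μ i) * ⟪dualBasis hL he i, emb hL u⟫_ℝ = ⟪e i, u⟫_ℝ := by
  have hp := hL.eigenvalue_pos he i
  rw [dualBasis_apply, real_inner_smul_left, inner_emb_emb hL hp.ne' (he i), ← mul_assoc,
    Real.mul_self_sqrt hp.le, mul_inv_cancel_left₀ hp.ne']

lemma inner_dualBasis_lapl (hL : IsAdmissible L) (he : ∀ i, e i ∈ eigenspace L (μ i)) (i : ι)
    (v : V hL) : ⟪dualBasis hL he i, lapl hL v⟫_ℝ = √(μ i) * ⟪e i, V.val hL v⟫_ℝ := by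
  rw [dualBasis_apply, real_inner_smul_left, real_inner_comm, inner_lapl_emb, real_inner_comm]

lemma dualBasis_mem (hL : IsAdmissible L) (he : ∀ i, e i ∈ eigenspace L (μ i)) (i : ι) :
    dualBasis hL he i ∈ eigenspace (extOp hL) (μ i) := by
  rw [dualBasis_apply]
  exact Submodule.smul_mem _ _ (emb_mem_eigenspace hL (he i))

lemma eigenproj_dualBasis (hL : IsAdmissible L) (he : ∀ i, e i ∈ eigenspace L (μ i)) (i : ι)
    {k : ℝ} (hk : k ≠ μ i) : eigenproj (extOp hL) k (dualBasis hL he i) = 0 :=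
  eigenproj_eq_zero fun _ hy => extOp_ortho hL hk hy (dualBasis_mem hL he i)

lemma inner_dualBasis_fracPow (hL : IsAdmissible L) (he : ∀ i, e i ∈ eigenspace L (μ i)) (i : ι)
    {s : ℝ} (g : (fracPow (extOp hL) s).domain) :
    ⟪dualBasis hL he i, fracPow (extOp hL) s g⟫_ℝ
      = μ i ^ s * ⟪dualBasis hL he i, (g : DualV hL)⟫_ℝ :=
  inner_fracPow_eigenvector (dualBasis_mem hL he i)
    (fun _ hk => eigenproj_dualBasis hL he i hk) g

lemma dualBasis_mem_fracPow (hL : IsAdmissible L) (he : ∀ i, e i ∈ eigenspace L (μ i)) (i : ι)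
    (s : ℝ) : dualBasis hL he i ∈ (fracPow (extOp hL) s).domain :=
  (hasSum_fracPow_eigenvector s (dualBasis_mem hL he i)
    fun _ hk => eigenproj_dualBasis hL he i hk).summable

lemma hasSum_inner_sq {E : Type*} [NormedAddCommGroup E] [InnerProductSpace ℝ E]
    (b : HilbertBasis ι ℝ E) (x : E) : HasSum (fun i => ⟪b i, x⟫_ℝ ^ 2) (‖x‖ ^ 2) := by
  have h := b.hasSum_inner_mul_inner x x
  rw [real_inner_self_eq_norm_sq] at h
  refine h.congr_fun fun i => ?_
  rw [real_inner_comm x, sq]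

/-- The coordinates of an element `(x₁, x₂)` of `H`: the `i`-th one is the complex number whose
real and imaginary parts are the coefficients of `x₁` and `x₂`. -/
def coordEquiv (hL : IsAdmissible L) (he : ∀ i, e i ∈ eigenspace L (μ i)) :
    H hL ≃ₗᵢ[ℝ] lp (fun _ : ι => ℂ) 2 :=
  -- Here `ℂ` serves as the Euclidean plane. Parseval in `U` and in `V'` gives both square
  -- summability and the isometry.
  have hs : ∀ x : H hL, HasSum (fun i => ‖(⟨⟪e i, H.fst hL x⟫_ℝ,
      ⟪dualBasis hL he i, H.snd hL x⟫_ℝ⟩ : ℂ)‖ ^ 2) (‖x‖ ^ 2) := fun x => by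
    rw [H.norm_sq]
    refine ((hasSum_inner_sq e _).add (hasSum_inner_sq (dualBasis hL he) _)).congr_fun
      fun i => ?_
    rw [Complex.sq_norm, Complex.normSq_apply, ← sq, ← sq]
    rfl
  LinearIsometryEquiv.ofSurjective
    { toFun := fun x => ⟨fun i => ⟨⟪e i, H.fst hL x⟫_ℝ, ⟪dualBasis hL he i, H.snd hL x⟫_ℝ⟩,
        memℓp_gen <| by simpa using (hs x).summable⟩
      map_add' := fun x y => lp.ext <| funext fun i => Complex.ext
        ((congrArg _ (map_add (H.fst hL) x y)).trans (inner_add_right _ _ _))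
        ((congrArg _ (map_add (H.snd hL) x y)).trans (inner_add_right _ _ _))
      map_smul' := fun c x => lp.ext <| funext fun i => Complex.ext
        (by simp [real_inner_smul_right]) (by simp [real_inner_smul_right])
      norm_map' := fun x => by
        refine (sq_eq_sq₀ (norm_nonneg _) (norm_nonneg _)).1 ?_
        rw [lp_two_norm_sq]
        exact (hs x).tsum_eq }
    fun c => by
      have h1 : Memℓp (fun i => (c i).re) 2 := memℓp_gen <| by
        have h : Summable fun i => ‖(c i).re‖ ^ 2 :=
          (lp_two_summable c).of_nonneg_of_le (fun _ => sq_nonneg _)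
            fun i => pow_le_pow_left₀ (norm_nonneg _) (Complex.abs_re_le_norm _) 2
        simpa using h
      have h2 : Memℓp (fun i => (c i).im) 2 := memℓp_gen <| by
        have h : Summable fun i => ‖(c i).im‖ ^ 2 :=
          (lp_two_summable c).of_nonneg_of_le (fun _ => sq_nonneg _)
            fun i => pow_le_pow_left₀ (norm_nonneg _) (Complex.abs_im_le_norm _) 2
        simpa using h
      refine ⟨(H.equiv hL).symm (e.repr.symm ⟨_, h1⟩, (dualBasis hL he).repr.symm ⟨_, h2⟩),
        lp.ext <| funext fun i => Complex.ext ?_ ?_⟩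
      · change ⟪e i, e.repr.symm ⟨_, h1⟩⟫_ℝ = _
        rw [← e.repr_apply_apply, LinearIsometryEquiv.apply_symm_apply]
      · change ⟪dualBasis hL he i, (dualBasis hL he).repr.symm ⟨_, h2⟩⟫_ℝ = _
        rw [← (dualBasis hL he).repr_apply_apply, LinearIsometryEquiv.apply_symm_apply]

lemma coordEquiv_re (hL : IsAdmissible L) (he : ∀ i, e i ∈ eigenspace L (μ i)) (x : H hL)
    (i : ι) : (coordEquiv hL he x i).re = ⟪e i, H.fst hL x⟫_ℝ := rfl

lemma coordEquiv_im (hL : IsAdmissible L) (he : ∀ i, e i ∈ eigenspace L (μ i)) (x : H hL)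
    (i : ι) : (coordEquiv hL he x i).im = ⟪dualBasis hL he i, H.snd hL x⟫_ℝ := rfl

/-! ### The damped wave operator in coordinates -/

/-- The matrix `[[0, √m], [-√m, -r]]` of the damped oscillator. -/
def oscillator (m r : ℝ) : ℂ →L[ℝ] ℂ :=
  LinearMap.toContinuousLinearMap
    { toFun := fun z => ⟨√m * z.im, -(√m * z.re) - r * z.im⟩
      map_add' := fun z w => by
        apply Complex.ext <;> simp <;> ring
      map_smul' := fun c z => by
        apply Complex.ext <;> simp <;> ring }

lemma oscillator_apply (m r : ℝ) (z : ℂ) :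
    oscillator m r z = ⟨√m * z.im, -(√m * z.re) - r * z.im⟩ := rfl

/-- The terms with `√m` cancel by skew-symmetry, which leaves `-r (im z) ^ 2`. -/
lemma oscillator_dissipative (m : ℝ) {r : ℝ} (hr : 0 ≤ r) (z : ℂ) :
    ⟪oscillator m r z, z⟫_ℝ ≤ 0 := by
  rw [Complex.inner, oscillator_apply]
  simp only [Complex.mul_re, Complex.conj_re, Complex.conj_im]
  nlinarith [mul_nonneg hr (sq_nonneg z.im)]

lemma coordEquiv_waveOp (hL : IsAdmissible L) (he : ∀ i, e i ∈ eigenspace L (μ i)) (α ρ : ℝ)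
    (x : (waveOp hL α ρ).domain) (i : ι) :
    coordEquiv hL he (waveOp hL α ρ x) i
      = oscillator (μ i) (ρ * μ i ^ α) (coordEquiv hL he x i) := by
  obtain ⟨x, hx⟩ := x
  change x ∈ waveDomain hL α at hx
  -- `domSnd` is the preimage in `U` of the second component, so embedding it recovers that
  -- component.
  have hsnd : emb hL (domSnd hL α ⟨x, hx⟩) = H.snd hL x :=
    congrArg Subtype.val (LinearEquiv.apply_symm_apply
      (LinearEquiv.ofInjective (emb hL).toLinearMap (emb_injective hL)) ⟨H.snd hL x, hx.2.1⟩)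
  refine Complex.ext ?_ ?_
  · rw [coordEquiv_re, oscillator_apply, coordEquiv_im, ← hsnd, inner_dualBasis_emb]
    rfl
  · rw [coordEquiv_im, oscillator_apply, coordEquiv_im, coordEquiv_re]
    have hpow := inner_dualBasis_fracPow hL he i (s := α) ⟨H.snd hL x, hx.2.2⟩
    have hlap := inner_dualBasis_lapl hL he i (domFst hL α ⟨x, hx⟩)
    change ⟪dualBasis hL he i, -(lapl hL (domFst hL α ⟨x, hx⟩)) - ρ •
      fracPow (extOp hL) α ⟨H.snd hL x, hx.2.2⟩⟫_ℝ = _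
    rw [inner_sub_right, inner_neg_right, real_inner_smul_right, hpow, hlap, mul_assoc]
    rfl

/-- Both components are multiples of eigenvectors, which belong to the domains of all powers. -/
lemma mem_waveOp_domain (hL : IsAdmissible L) (he : ∀ i, e i ∈ eigenspace L (μ i)) (α ρ : ℝ)
    (x : H hL) (i : ι) (h : ∀ j, j ≠ i → coordEquiv hL he x j = 0) :
    x ∈ (waveOp hL α ρ).domain := by
  have h1 : H.fst hL x = ⟪e i, H.fst hL x⟫_ℝ • e i := by
    refine hilbertBasis_ext e fun j => ?_
    rw [real_inner_smul_right]
    by_cases hj : j = i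
    · subst hj
      simp [e.orthonormal.norm_eq_one]
    · rw [e.orthonormal.inner_eq_zero hj, mul_zero, ← coordEquiv_re hL he, h j hj, Complex.zero_re]
  have h2 : H.snd hL x = ⟪dualBasis hL he i, H.snd hL x⟫_ℝ • dualBasis hL he i := by
    refine hilbertBasis_ext (dualBasis hL he) fun j => ?_
    rw [real_inner_smul_right]
    by_cases hj : j = i
    · subst hj
      simp [(dualBasis hL he).orthonormal.norm_eq_one]
    · rw [(dualBasis hL he).orthonormal.inner_eq_zero hj, mul_zero, ← coordEquiv_im hL he, h j hj,
        Complex.zero_im]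
  refine ⟨?_, ?_, ?_⟩
  · change H.fst hL x ∈ (fracPow L (1 / 2)).domain
    rw [h1]
    exact Submodule.smul_mem _ _ (hL.mem_fracPow_domain (he i) _)
  · change H.snd hL x ∈ LinearMap.range (emb hL).toLinearMap
    rw [h2, dualBasis_apply]
    exact Submodule.smul_mem _ _ (Submodule.smul_mem _ _ ⟨e i, rfl⟩)
  · change H.snd hL x ∈ (fracPow (extOp hL) α).domain
    rw [h2]
    exact Submodule.smul_mem _ _ (dualBasis_mem_fracPow hL he i α)

theorem exists_generates_waveOp (hL : IsAdmissible L) {α ρ : ℝ} (hρ : 0 ≤ ρ) :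
    ∃ S : ℝ → H hL →L[ℝ] H hL, Generates (waveOp hL α ρ) S := by
  obtain ⟨ι, e, μ, he⟩ := hL.exists_eigenbasis
  exact ⟨_, generates_conjFlow (coordEquiv hL he) (fun i => oscillator (μ i) (ρ * μ i ^ α))
    (fun i => oscillator_dissipative _
      (mul_nonneg hρ (Real.rpow_nonneg (hL.eigenvalue_pos he i).le _)))
    (waveOp hL α ρ) (coordEquiv_waveOp hL he α ρ) (mem_waveOp_domain hL he α ρ)⟩

/-- The semigroup acts as a contraction on each vector `G e_i`. -/
theorem norm_semigroup_G_sq_le (hL : IsAdmissible L) (he : ∀ i, e i ∈ eigenspace L (μ i))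
    {α ρ : ℝ} (hρ : 0 ≤ ρ) {S : ℝ → H hL →L[ℝ] H hL} (hS : Generates (waveOp hL α ρ) S) {t : ℝ}
    (ht : 0 ≤ t) (i : ι) : ‖S t (G hL (e i))‖ ^ 2 ≤ (μ i)⁻¹ := by
  have hp := hL.eigenvalue_pos he i
  -- Being supported in one block, `G (e i)` lies in the domain, as `Generates.coord_eq` requires.
  have hG : ∀ j, j ≠ i → coordEquiv hL he (G hL (e i)) j = 0 := fun j hj => by
    refine Complex.ext ?_ ?_
    · rw [coordEquiv_re]
      exact inner_zero_right _
    · rw [coordEquiv_im]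
      change ⟪dualBasis hL he j, emb hL (e i)⟫_ℝ = 0
      have h := inner_dualBasis_emb hL he j (e i)
      rw [e.orthonormal.inner_eq_zero hj] at h
      exact (mul_eq_zero.1 h).resolve_left (Real.sqrt_pos.2 (hL.eigenvalue_pos he j)).ne'
  have hle : ‖S t (G hL (e i))‖ ^ 2 ≤ ‖G hL (e i)‖ ^ 2 := by
    rw [← (coordEquiv hL he).norm_map, ← (coordEquiv hL he).norm_map (G hL (e i)),
      lp_two_norm_sq, lp_two_norm_sq]
    refine Summable.tsum_le_tsum (fun j => ?_) (lp_two_summable _) (lp_two_summable _)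
    rw [hS.coord_eq (coordEquiv hL he) (fun i => oscillator (μ i) (ρ * μ i ^ α))
      (waveOp hL α ρ) (coordEquiv_waveOp hL he α ρ) (mem_waveOp_domain hL he α ρ) ht
      (mem_waveOp_domain hL he α ρ _ i hG)]
    exact pow_le_pow_left₀ (norm_nonneg _) (norm_expFlow_apply_le (oscillator_dissipative _
      (mul_nonneg hρ (Real.rpow_nonneg (hL.eigenvalue_pos he j).le _))) ht _) 2
  refine hle.trans_eq ?_
  rw [H.norm_sq]
  change ‖(0 : U)‖ ^ 2 + ‖emb hL (e i)‖ ^ 2 = _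
  rw [← real_inner_self_eq_norm_sq (emb hL (e i)), inner_emb_emb hL hp.ne' (he i),
    real_inner_self_eq_norm_sq, e.orthonormal.norm_eq_one]
  simp

end Coordinates

/-! ### Hilbert-Schmidt norms -/

section HilbertSchmidt

variable {U E ι : Type*} [NormedAddCommGroup U] [InnerProductSpace ℝ U]
  [NormedAddCommGroup E] [InnerProductSpace ℝ E]

lemma enorm_sq_eq_ofReal {F : Type*} [NormedAddCommGroup F] (x : F) :
    ‖x‖ₑ ^ 2 = ENNReal.ofReal (‖x‖ ^ 2) := by
  rw [ENNReal.ofReal_pow (norm_nonneg _), ofReal_norm]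

lemma norm_sum_smul_sq {κ : Type*} [Fintype κ] (c : κ → ℝ) (y : κ → E) :
    ‖∑ i, c i • y i‖ ^ 2 = ∑ i, ∑ j, c i * c j * ⟪y i, y j⟫_ℝ := by
  rw [← real_inner_self_eq_norm_sq, sum_inner]
  refine Finset.sum_congr rfl fun i _ => ?_
  rw [inner_sum]
  refine Finset.sum_congr rfl fun j _ => ?_
  rw [real_inner_smul_left, real_inner_smul_right]
  ring

/-- The square is expanded and Parseval is applied to each pair `(i, j)`. The resulting Gram form is
the one in which the covariance of Wiener increments appears in the Itô isometry. -/
lemma hasSum_norm_sum_smulRight_sq {κ : Type*} [Fintype κ] (b : HilbertBasis ι ℝ U) (c : κ → ℝ)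
    (u : κ → U) (y : κ → E) :
    HasSum (fun k => ‖(∑ i, c i • (innerSL ℝ (u i)).smulRight (y i)) (b k)‖ ^ 2)
      (∑ i, ∑ j, c i * c j * (⟪u i, u j⟫_ℝ * ⟪y i, y j⟫_ℝ)) := by
  have h : ∀ i j, HasSum (fun k => c i * c j * (⟪u i, b k⟫_ℝ * ⟪b k, u j⟫_ℝ * ⟪y i, y j⟫_ℝ))
      (c i * c j * (⟪u i, u j⟫_ℝ * ⟪y i, y j⟫_ℝ)) := fun i j =>
    ((b.hasSum_inner_mul_inner (u i) (u j)).mul_right _).mul_left _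
  refine (hasSum_sum fun i _ => hasSum_sum fun j _ => h i j).congr_fun fun k => ?_
  have e : (∑ i, c i • (innerSL ℝ (u i)).smulRight (y i)) (b k)
      = ∑ i, (c i * ⟪u i, b k⟫_ℝ) • y i := by
    simp [smul_smul]
  rw [e, norm_sum_smul_sq]
  refine Finset.sum_congr rfl fun i _ => Finset.sum_congr rfl fun j _ => ?_
  rw [real_inner_comm (u j)]
  ring

lemma enorm_add_sq_le {F : Type*} [NormedAddCommGroup F] (x y : F) :
    ‖x + y‖ₑ ^ 2 ≤ 2 * ‖x‖ₑ ^ 2 + 2 * ‖y‖ₑ ^ 2 := by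
  simp only [enorm_sq_eq_ofReal]
  rw [← ENNReal.ofReal_ofNat 2, ← ENNReal.ofReal_mul (by norm_num),
    ← ENNReal.ofReal_mul (by norm_num), ← ENNReal.ofReal_add (by positivity) (by positivity)]
  refine ENNReal.ofReal_le_ofReal ?_
  have := norm_add_le x y
  nlinarith [norm_nonneg (x + y), sq_nonneg (‖x‖ - ‖y‖)]

variable [CompleteSpace U]

lemma hsNorm_neg (T : U →L[ℝ] E) : hsNorm (-T) = hsNorm T := by
  simp [hsNorm]

variable [CompleteSpace E]

lemma hsNorm_sq_eq (b : HilbertBasis ι ℝ U) (T : U →L[ℝ] E) :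
    hsNorm T ^ 2 = ∑' i, ‖T (b i)‖ₑ ^ 2 := by
  rw [hsNorm_eq b, ← ENNReal.rpow_natCast, ← ENNReal.rpow_mul]
  norm_num

lemma hsNorm_add_sq_le (S T : U →L[ℝ] E) :
    hsNorm (S + T) ^ 2 ≤ 2 * hsNorm S ^ 2 + 2 * hsNorm T ^ 2 := by
  obtain ⟨w, b, -⟩ := exists_hilbertBasis ℝ U
  rw [hsNorm_sq_eq b, hsNorm_sq_eq b, hsNorm_sq_eq b, ← ENNReal.tsum_mul_left,
    ← ENNReal.tsum_mul_left, ← ENNReal.tsum_add]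
  exact ENNReal.tsum_le_tsum fun i => enorm_add_sq_le _ _

/-- The Hilbert-Schmidt norm of an operator of finite rank. -/
lemma hsNorm_sum_smulRight_sq {κ : Type*} [Fintype κ] (c : κ → ℝ) (u : κ → U) (y : κ → E) :
    hsNorm (∑ i, c i • (innerSL ℝ (u i)).smulRight (y i)) ^ 2
      = ENNReal.ofReal (∑ i, ∑ j, c i * c j * (⟪u i, u j⟫_ℝ * ⟪y i, y j⟫_ℝ)) := by
  obtain ⟨w, b, -⟩ := exists_hilbertBasis ℝ U
  have hs := hasSum_norm_sum_smulRight_sq b c u y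
  rw [hsNorm_sq_eq b, ← hs.tsum_eq, ENNReal.ofReal_tsum_of_nonneg (fun _ => sq_nonneg _)
    hs.summable]
  exact tsum_congr fun k => enorm_sq_eq_ofReal _

end HilbertSchmidt

/-! ### Elementary integrands -/

section ElementaryIntegrands

variable {U E Ω : Type*} [NormedAddCommGroup U] [InnerProductSpace ℝ U]
  [NormedAddCommGroup E] [NormedSpace ℝ E] {t : ℝ≥0}

/-- An elementary integrand indexed by an arbitrary finite type. -/
def Elementary.ofFintype {U E κ : Type*} [Fintype κ] (a b : κ → ℝ≥0) (u : κ → U) (y : κ → E)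
    (hab : ∀ i, a i ≤ b i) (hb : ∀ i, b i ≤ t) : Elementary U E t where
  n := Fintype.card κ
  a i := a ((Fintype.equivFin κ).symm i)
  b i := b ((Fintype.equivFin κ).symm i)
  u i := u ((Fintype.equivFin κ).symm i)
  y i := y ((Fintype.equivFin κ).symm i)
  a_le_b _ := hab _
  b_le _ := hb _

lemma Elementary.toFun_ofFintype {κ : Type*} [Fintype κ] (a b : κ → ℝ≥0) (u : κ → U) (y : κ → E)
    (hab : ∀ i, a i ≤ b i) (hb : ∀ i, b i ≤ t) (s : ℝ) :
    (Elementary.ofFintype a b u y hab hb).toFun s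
      = ∑ i, (Ioc (a i : ℝ) (b i)).indicator (fun _ => (innerSL ℝ (u i)).smulRight (y i)) s :=
  (Fintype.equivFin κ).symm.sum_comp
    fun i => (Ioc (a i : ℝ) (b i)).indicator (fun _ => (innerSL ℝ (u i)).smulRight (y i)) s

lemma Elementary.integral_ofFintype {U κ : Type*} [Fintype κ] (a b : κ → ℝ≥0) (u : κ → U)
    (y : κ → E) (hab : ∀ i, a i ≤ b i) (hb : ∀ i, b i ≤ t) (W : ℝ≥0 → U → Ω → ℝ) (ω : Ω) :
    (Elementary.ofFintype a b u y hab hb).integral W ω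
      = ∑ i, (W (b i) (u i) ω - W (a i) (u i) ω) • y i :=
  (Fintype.equivFin κ).symm.sum_comp fun i => (W (b i) (u i) ω - W (a i) (u i) ω) • y i

/-- The difference of two elementary integrands. -/
def Elementary.sub {U : Type*} (f g : Elementary U E t) : Elementary U E t :=
  Elementary.ofFintype (Sum.elim f.a g.a) (Sum.elim f.b g.b) (Sum.elim f.u g.u)
    (Sum.elim f.y fun i => -g.y i) (Sum.rec f.a_le_b g.a_le_b) (Sum.rec f.b_le g.b_le)

lemma Elementary.toFun_sub (f g : Elementary U E t) (s : ℝ) :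
    (f.sub g).toFun s = f.toFun s - g.toFun s := by
  rw [Elementary.sub, Elementary.toFun_ofFintype, Fintype.sum_sum_type, sub_eq_add_neg,
    Elementary.toFun, Elementary.toFun, ← Finset.sum_neg_distrib]
  congr 1
  refine Finset.sum_congr rfl fun i _ => ?_
  by_cases hs : s ∈ Ioc (g.a i : ℝ) (g.b i)
  · rw [indicator_of_mem hs]
    refine (indicator_of_mem hs _).trans ?_
    ext v
    simp
  · rw [indicator_of_notMem hs, neg_zero]
    exact indicator_of_notMem hs _

lemma Elementary.integral_sub {U : Type*} (f g : Elementary U E t) (W : ℝ≥0 → U → Ω → ℝ) (ω : Ω) :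
    (f.sub g).integral W ω = f.integral W ω - g.integral W ω := by
  rw [Elementary.sub, Elementary.integral_ofFintype, Fintype.sum_sum_type]
  simp [Elementary.integral, sub_eq_add_neg]

end ElementaryIntegrands

/-! ### The Itô isometry -/

section Isometry

variable {U E Ω : Type*} [NormedAddCommGroup U] [InnerProductSpace ℝ U] [MeasurableSpace Ω]
  {P : Measure Ω} {W : ℝ≥0 → U → Ω → ℝ} {t : ℝ≥0}

lemma IsCylindricalWiener.memLp (hW : IsCylindricalWiener W P) (s : ℝ≥0) (u : U) :
    MemLp (W s u) 2 P :=
  (hW.gaussian.hasGaussianLaw_eval (s, u)).memLp_two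

lemma IsCylindricalWiener.memLp_increment (hW : IsCylindricalWiener W P) (a b : ℝ≥0) (u : U) :
    MemLp (fun ω => W b u ω - W a u ω) 2 P :=
  (hW.memLp b u).sub (hW.memLp a u)

lemma IsCylindricalWiener.integrable_mul (hW : IsCylindricalWiener W P) (s r : ℝ≥0) (u v : U) :
    Integrable (fun ω => W s u ω * W r v ω) P :=
  (hW.memLp s u).integrable_mul (hW.memLp r v)

/-- The left side is the length of the overlap of `(a, b]` and `(c, d]`, the right side the
covariance of the Brownian increments over them. -/
lemma length_Ioc_inter {a b c d : ℝ} (hab : a ≤ b) (hcd : c ≤ d) :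
    max (min b d - max a c) 0 = min b d - min b c - min a d + min a c := by
  grind

lemma IsCylindricalWiener.integral_increment_mul (hW : IsCylindricalWiener W P)
    {a b c d : ℝ≥0} (hab : a ≤ b) (hcd : c ≤ d) (hb : b ≤ t) (u v : U) :
    ∫ ω, (W b u ω - W a u ω) * (W d v ω - W c v ω) ∂P
      = (∫ s in Ioc (0 : ℝ) t, (Ioc (a : ℝ) b).indicator 1 s * (Ioc (c : ℝ) d).indicator 1 s)
        * ⟪u, v⟫_ℝ := by
  have hl : ∫ ω, (W b u ω - W a u ω) * (W d v ω - W c v ω) ∂P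
      = (min (b : ℝ) d - min (b : ℝ) c - min (a : ℝ) d + min (a : ℝ) c) * ⟪u, v⟫_ℝ := by
    have e : ∀ ω, (W b u ω - W a u ω) * (W d v ω - W c v ω)
        = W b u ω * W d v ω - W b u ω * W c v ω - (W a u ω * W d v ω - W a u ω * W c v ω) :=
      fun ω => by ring
    have hi : ∀ r, Integrable (fun ω => W r u ω * W d v ω - W r u ω * W c v ω) P := fun r =>
      (hW.integrable_mul _ _ _ _).sub (hW.integrable_mul _ _ _ _)
    simp_rw [e]
    rw [integral_sub (hi b) (hi a),
      integral_sub (hW.integrable_mul _ _ _ _) (hW.integrable_mul _ _ _ _),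
      integral_sub (hW.integrable_mul _ _ _ _) (hW.integrable_mul _ _ _ _)]
    simp only [hW.covariance]
    ring
  have hr : ∫ s in Ioc (0 : ℝ) t, (Ioc (a : ℝ) b).indicator 1 s * (Ioc (c : ℝ) d).indicator 1 s
      = max (min (b : ℝ) d - max (a : ℝ) c) 0 := by
    -- The overlap lies in `(0, t]`, so restricting Lebesgue measure loses nothing.
    have hsub : Ioc (a : ℝ) b ∩ Ioc (c : ℝ) d ⊆ Ioc (0 : ℝ) t := fun s hs =>
      ⟨lt_of_le_of_lt a.2 hs.1.1, hs.1.2.trans (NNReal.coe_le_coe.2 hb)⟩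
    have e : ∀ s : ℝ, (Ioc (a : ℝ) b).indicator 1 s * (Ioc (c : ℝ) d).indicator 1 s
        = (Ioc (a : ℝ) b ∩ Ioc (c : ℝ) d).indicator (1 : ℝ → ℝ) s := fun s => by
      rw [inter_indicator_one]
      rfl
    simp_rw [e]
    rw [integral_indicator_one (measurableSet_Ioc.inter measurableSet_Ioc),
      measureReal_restrict_apply (measurableSet_Ioc.inter measurableSet_Ioc),
      inter_eq_left.2 hsub, Ioc_inter_Ioc, Real.volume_real_Ioc]
  rw [hl, hr, length_Ioc_inter (NNReal.coe_le_coe.2 hab) (NNReal.coe_le_coe.2 hcd)]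

variable [NormedAddCommGroup E] [InnerProductSpace ℝ E]

lemma Elementary.memLp_integral (hW : IsCylindricalWiener W P) (f : Elementary U E t) :
    MemLp (f.integral W) 2 P := by
  have h : ∀ i ∈ Finset.univ, MemLp (fun ω => (W (f.b i) (f.u i) ω - W (f.a i) (f.u i) ω) • f.y i)
      2 P := fun i _ =>
    (ContinuousLinearMap.toSpanSingleton ℝ (f.y i)).comp_memLp' (hW.memLp_increment _ _ _)
  exact memLp_finsetSum _ h

lemma eLpNorm_two_sq {F : Type*} [NormedAddCommGroup F] (X : Ω → F) :
    eLpNorm X 2 P ^ 2 = ∫⁻ ω, ‖X ω‖ₑ ^ 2 ∂P := by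
  have h := eLpNorm_nnreal_pow_eq_lintegral (μ := P) (f := X) (p := 2) two_ne_zero
  simpa using h

/-- The Itô isometry for elementary integrands. -/
theorem Elementary.isometry [CompleteSpace U] [CompleteSpace E] (hW : IsCylindricalWiener W P)
    (f : Elementary U E t) :
    eLpNorm (f.integral W) 2 P ^ 2 = ∫⁻ s in Ioc (0 : ℝ) t, hsNorm (f.toFun s) ^ 2 := by
  let c : Fin f.n → ℝ → ℝ := fun i => (Ioc (f.a i : ℝ) (f.b i)).indicator 1
  have hf : ∀ s, f.toFun s = ∑ i, c i s • (innerSL ℝ (f.u i)).smulRight (f.y i) := fun s =>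
    Finset.sum_congr rfl fun i _ => by
      simp only [c, indicator]
      split_ifs <;> simp
  have hc : ∀ i j, Integrable (fun s => c i s * c j s) (volume.restrict (Ioc (0 : ℝ) t)) := by
    intro i j
    have e : (fun s => c i s * c j s)
        = (Ioc (f.a i : ℝ) (f.b i) ∩ Ioc (f.a j : ℝ) (f.b j)).indicator 1 := by
      rw [inter_indicator_one]
      rfl
    rw [e]
    exact (integrable_const (1 : ℝ)).indicator (measurableSet_Ioc.inter measurableSet_Ioc)
  have hd : ∀ i j, Integrable (fun ω => (W (f.b i) (f.u i) ω - W (f.a i) (f.u i) ω)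
      * (W (f.b j) (f.u j) ω - W (f.a j) (f.u j) ω)) P := fun i j =>
    (hW.memLp_increment _ _ _).integrable_mul (hW.memLp_increment _ _ _)
  -- The Gram form is a squared Hilbert-Schmidt norm; its sign is needed to turn the lower integral
  -- into a Bochner integral.
  have hnonneg : ∀ s, 0 ≤ ∑ i, ∑ j, c i s * c j s * (⟪f.u i, f.u j⟫_ℝ * ⟪f.y i, f.y j⟫_ℝ) := by
    obtain ⟨w, b, -⟩ := exists_hilbertBasis ℝ U
    exact fun s => (hasSum_norm_sum_smulRight_sq b (fun i => c i s) f.u f.y).nonneg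
      fun _ => sq_nonneg _
  have hright : ∫⁻ s in Ioc (0 : ℝ) t, hsNorm (f.toFun s) ^ 2 = ENNReal.ofReal
      (∑ i, ∑ j, (∫ s in Ioc (0 : ℝ) t, c i s * c j s)
        * (⟪f.u i, f.u j⟫_ℝ * ⟪f.y i, f.y j⟫_ℝ)) := by
    simp_rw [hf, hsNorm_sum_smulRight_sq]
    rw [← ofReal_integral_eq_lintegral_ofReal (integrable_finsetSum _ fun i _ =>
      integrable_finsetSum _ fun j _ => (hc i j).mul_const _) (Eventually.of_forall hnonneg)]
    congr 1
    rw [integral_finsetSum _ fun i _ => integrable_finsetSum _ fun j _ => (hc i j).mul_const _]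
    refine Finset.sum_congr rfl fun i _ => ?_
    rw [integral_finsetSum _ fun j _ => (hc i j).mul_const _]
    exact Finset.sum_congr rfl fun j _ => integral_mul_const _ _
  rw [hright, eLpNorm_two_sq]
  simp_rw [enorm_sq_eq_ofReal]
  rw [← ofReal_integral_eq_lintegral_ofReal ((memLp_two_iff_integrable_sq_norm
    (f.memLp_integral hW).1).1 (f.memLp_integral hW))
    (Eventually.of_forall fun ω => sq_nonneg _)]
  congr 1
  simp_rw [Elementary.integral, norm_sum_smul_sq]
  rw [integral_finsetSum _ fun i _ => integrable_finsetSum _ fun j _ => (hd i j).mul_const _]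
  refine Finset.sum_congr rfl fun i _ => ?_
  rw [integral_finsetSum _ fun j _ => (hd i j).mul_const _]
  refine Finset.sum_congr rfl fun j _ => ?_
  rw [integral_mul_const, hW.integral_increment_mul (f.a_le_b i) (f.a_le_b j) (f.b_le i), mul_assoc]

lemma Elementary.eLpNorm_integral_sub_sq [CompleteSpace U] [CompleteSpace E]
    (hW : IsCylindricalWiener W P) (f g : Elementary U E t) :
    eLpNorm (fun ω => f.integral W ω - g.integral W ω) 2 P ^ 2
      = ∫⁻ s in Ioc (0 : ℝ) t, hsNorm (f.toFun s - g.toFun s) ^ 2 := by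
  simp_rw [← Elementary.integral_sub, ← Elementary.toFun_sub]
  exact (f.sub g).isometry hW

end Isometry

/-! ### Approximation by elementary integrands -/

section Approximation

variable {U E ι : Type*} [NormedAddCommGroup U] [InnerProductSpace ℝ U] [CompleteSpace U]
  [NormedAddCommGroup E] [InnerProductSpace ℝ E] [CompleteSpace E] {t : ℝ≥0}

/-- The intervals of a uniform partition of `(0, t]` cover it and are disjoint. -/
lemma exists_mem_partition_iff {N : ℕ} (hN : 0 < N) {s : ℝ} (hs : s ∈ Ioc (0 : ℝ) t) :
    ∃ k₀ : Fin N, ∀ k : Fin N,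
      s ∈ Ioc (t * k / N : ℝ) (t * (k + 1) / N) ↔ k = k₀ := by
  have ht : (0 : ℝ) < t := hs.1.trans_le hs.2
  have hN' : (0 : ℝ) < N := Nat.cast_pos.2 hN
  have hpos : 0 < s * N / t := div_pos (mul_pos hs.1 hN') ht
  have hle : ⌈s * N / t⌉₊ ≤ N := by
    rw [Nat.ceil_le, div_le_iff₀ ht, mul_comm]
    exact mul_le_mul_of_nonneg_left hs.2 hN'.le
  have h0 : 0 < ⌈s * N / t⌉₊ := Nat.ceil_pos.2 hpos
  -- The cells are open on the left and closed on the right, so `s` lies in cell `k` exactly when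
  -- `⌈s N / t⌉ = k + 1`.
  refine ⟨⟨⌈s * N / t⌉₊ - 1, by omega⟩, fun k => ?_⟩
  have h1 : s ∈ Ioc (t * k / N : ℝ) (t * (k + 1) / N) ↔ ⌈s * N / t⌉₊ = (k : ℕ) + 1 := by
    rw [Nat.ceil_eq_iff (Nat.succ_ne_zero _), mem_Ioc, div_lt_iff₀ hN', le_div_iff₀ hN',
      lt_div_iff₀ ht, div_le_iff₀ ht, Nat.succ_sub_one, Nat.cast_succ, mul_comm (t : ℝ),
      mul_comm (t : ℝ)]
  rw [h1, Fin.ext_iff]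
  constructor
  · intro h
    simp [h]
  · intro h
    simp only at h
    omega

/-- Uniform continuity on `[0, t]`: with `n + 1` cells the mesh is below the modulus `η` as soon as
`n > t / η`. -/
lemma exists_uniform_partition {F : Type*} [PseudoMetricSpace F] {x : ℝ → F}
    (hx : ContinuousOn x (Icc 0 t)) {δ : ℝ} (hδ : 0 < δ) :
    ∃ N : ℕ, 0 < N ∧ ∀ k < N, ∀ s ∈ Ioc (t * k / N : ℝ) (t * (k + 1) / N),
      dist (x (t * k / N)) (x s) < δ := by
  obtain ⟨η, hη, h⟩ := Metric.uniformContinuousOn_iff.1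
    (isCompact_Icc.uniformContinuousOn_of_continuous hx) δ hδ
  obtain ⟨n, hn⟩ := exists_nat_gt (t / η : ℝ)
  have hN : (0 : ℝ) < (n + 1 : ℕ) := by positivity
  refine ⟨n + 1, n.succ_pos, fun k hk s hs => ?_⟩
  have hk' : ((k : ℝ) + 1) ≤ (n + 1 : ℕ) := by exact_mod_cast hk
  have h1 : (0 : ℝ) ≤ t * k / (n + 1 : ℕ) := by positivity
  have h2 : (t * (k + 1) / (n + 1 : ℕ) : ℝ) ≤ t := by
    rw [div_le_iff₀ hN]
    exact mul_le_mul_of_nonneg_left hk' t.2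
  have h3 : (t * (k + 1) / (n + 1 : ℕ) : ℝ) - t * k / (n + 1 : ℕ) < η := by
    have : (t * (k + 1) / (n + 1 : ℕ) : ℝ) - t * k / (n + 1 : ℕ) = t / (n + 1 : ℕ) := by ring
    rw [this, div_lt_iff₀ hN, mul_comm, ← div_lt_iff₀ hη]
    push_cast
    linarith
  refine h _ ⟨h1, (hs.1.le.trans hs.2).trans h2⟩ _ ⟨h1.trans hs.1.le, hs.2.trans h2⟩ ?_
  rw [dist_comm, Real.dist_eq, abs_of_nonneg (sub_nonneg.2 hs.1.le)]
  linarith [hs.2]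

/-- Approximation of strongly continuous integrands, uniformly in the Hilbert-Schmidt norm. -/
lemma exists_elementary_hsNorm_le (b : HilbertBasis ι ℝ U) {Φ : ℝ → U →L[ℝ] E}
    (hΦ : ∀ u, ContinuousOn (fun s => Φ s u) (Icc 0 t)) {c : ι → ℝ≥0∞} (hc : ∑' i, c i ≠ ∞)
    (hb : ∀ s ∈ Ioc (0 : ℝ) t, ∀ i, ‖Φ s (b i)‖ₑ ^ 2 ≤ c i) {η : ℝ} (hη : 0 < η) :
    ∃ f : Elementary U E t, ∀ s ∈ Ioc (0 : ℝ) t,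
      hsNorm (f.toFun s - Φ s) ^ 2 ≤ ENNReal.ofReal η := by
  classical
  -- Outside the finite set `F` of basis vectors, the squared norms sum to less than `η / 2`,
  -- uniformly in `s`.
  obtain ⟨F, hF⟩ := ((ENNReal.tendsto_tsum_compl_atTop_zero hc).eventually_lt_const
    (ENNReal.ofReal_pos.2 (half_pos hη))).exists
  -- This makes the `F.card` errors `δ ^ 2` sum to at most `η / 2`; the `+ 1` covers an empty `F`.
  let δ : ℝ := √(η / 2 / (F.card + 1))
  have hδ : 0 < δ := Real.sqrt_pos.2 (by positivity)
  have hδ2 : F.card * δ ^ 2 ≤ η / 2 := by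
    rw [Real.sq_sqrt (by positivity), mul_div_assoc', div_le_iff₀ (by positivity)]
    nlinarith
  obtain ⟨N, hN, hpart⟩ := exists_uniform_partition (t := t)
    (x := fun s => fun i : F => Φ s (b i)) (continuousOn_pi.2 fun i => hΦ _) hδ
  have hN' : (0 : ℝ≥0) < N := Nat.cast_pos.2 hN
  -- On each cell the operator is frozen at the left endpoint and cut down to the span of the `b i`
  -- with `i ∈ F`.
  let f : Elementary U E t := Elementary.ofFintype (κ := F × Fin N)
    (fun p => t * (p.2 : ℕ) / N) (fun p => t * ((p.2 : ℕ) + 1) / N) (fun p => b p.1)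
    (fun p => Φ (t * (p.2 : ℕ) / N) (b p.1))
    (fun p => by
      gcongr
      exact le_self_add)
    (fun p => by
      rw [div_le_iff₀ hN']
      gcongr
      exact_mod_cast p.2.2)
  refine ⟨f, fun s hs => ?_⟩
  obtain ⟨k₀, hk₀⟩ := exists_mem_partition_iff hN hs
  have hval : ∀ i, f.toFun s (b i) = if i ∈ F then Φ (t * (k₀ : ℕ) / N) (b i) else 0 := by
    intro i
    have e : f.toFun s (b i) = ∑ j : F, if (j : ι) = i then Φ (t * (k₀ : ℕ) / N) (b j) else 0 := by
      simp only [f, Elementary.toFun_ofFintype]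
      rw [sum_apply, Fintype.sum_prod_type]
      refine Finset.sum_congr rfl fun j _ => ?_
      rw [Finset.sum_eq_single k₀]
      · rw [indicator_of_mem (by simpa using (hk₀ k₀).2 rfl)]
        rw [ContinuousLinearMap.smulRight_apply, innerSL_apply_apply,
          orthonormal_iff_ite.1 b.orthonormal]
        split_ifs <;> simp
      · intro k _ hk
        rw [indicator_of_notMem (by simpa using fun h => hk ((hk₀ k).1 h))]
        rfl
      · simp
    rw [e, Finset.sum_coe_sort F (fun j => if j = i then Φ (t * (k₀ : ℕ) / N) (b j) else 0),
      Finset.sum_ite_eq']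
  rw [hsNorm_sq_eq b, ← ENNReal.sum_add_tsum_compl F]
  have hin : ∑ i ∈ F, ‖(f.toFun s - Φ s) (b i)‖ₑ ^ 2 ≤ ENNReal.ofReal (η / 2) := by
    calc ∑ i ∈ F, ‖(f.toFun s - Φ s) (b i)‖ₑ ^ 2 ≤ ∑ i ∈ F, ENNReal.ofReal (δ ^ 2) := by
          refine Finset.sum_le_sum fun i hi => ?_
          rw [enorm_sq_eq_ofReal, sub_apply, hval, if_pos hi, ← dist_eq_norm]
          refine ENNReal.ofReal_le_ofReal (pow_le_pow_left₀ dist_nonneg ?_ 2)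
          exact (dist_le_pi_dist (fun i : F => Φ (t * (k₀ : ℕ) / N) (b i))
            (fun i : F => Φ s (b i)) ⟨i, hi⟩).trans
            (hpart k₀ k₀.2 s ((hk₀ k₀).2 rfl)).le
      _ = ENNReal.ofReal (F.card * δ ^ 2) := by
          rw [Finset.sum_const, nsmul_eq_mul, ENNReal.ofReal_mul (Nat.cast_nonneg _),
            ENNReal.ofReal_natCast]
      _ ≤ _ := ENNReal.ofReal_le_ofReal hδ2
  have hout : ∑' i : ((F : Set ι)ᶜ : Set ι), ‖(f.toFun s - Φ s) (b i)‖ₑ ^ 2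
      ≤ ENNReal.ofReal (η / 2) := by
    refine le_trans (ENNReal.tsum_le_tsum fun i => ?_) hF.le
    rw [sub_apply, hval, if_neg (fun h => i.2 (Finset.mem_coe.2 h)), zero_sub, enorm_neg]
    exact hb s hs i
  refine (add_le_add hin hout).trans_eq ?_
  rw [← ENNReal.ofReal_add (by positivity) (by positivity), add_halves]

lemma exists_elementary_lintegral_le (b : HilbertBasis ι ℝ U) {Φ : ℝ → U →L[ℝ] E}
    (hΦ : ∀ u, ContinuousOn (fun s => Φ s u) (Icc 0 t)) {c : ι → ℝ≥0∞} (hc : ∑' i, c i ≠ ∞)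
    (hb : ∀ s ∈ Ioc (0 : ℝ) t, ∀ i, ‖Φ s (b i)‖ₑ ^ 2 ≤ c i) {η : ℝ} (hη : 0 < η) :
    ∃ f : Elementary U E t,
      ∫⁻ s in Ioc (0 : ℝ) t, hsNorm (f.toFun s - Φ s) ^ 2 ≤ ENNReal.ofReal η := by
  -- The uniform error is taken to be `η / (t + 1)`, which also makes sense for `t = 0`.
  have ht : (0 : ℝ) < t + 1 := by positivity
  obtain ⟨f, hf⟩ := exists_elementary_hsNorm_le b hΦ hc hb (div_pos hη ht)
  refine ⟨f, (setLIntegral_mono' measurableSet_Ioc hf).trans ?_⟩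
  rw [setLIntegral_const, Real.volume_Ioc, sub_zero, ← ENNReal.ofReal_mul (by positivity)]
  refine ENNReal.ofReal_le_ofReal ?_
  rw [div_mul_eq_mul_div, div_le_iff₀ ht]
  nlinarith [t.2]

/-- A countable basis makes the squared norm a countable sum of measurable functions; this permits
splitting the lower integrals afterwards. -/
lemma Elementary.aemeasurable_hsNorm_sub_sq [Countable ι] (b : HilbertBasis ι ℝ U)
    {Φ : ℝ → U →L[ℝ] E} (hΦ : ∀ u, ContinuousOn (fun s => Φ s u) (Icc 0 t))
    (f : Elementary U E t) :
    AEMeasurable (fun s => hsNorm (f.toFun s - Φ s) ^ 2) (volume.restrict (Ioc (0 : ℝ) t)) := by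
  simp_rw [hsNorm_sq_eq b]
  refine AEMeasurable.tsum fun i => AEMeasurable.pow_const (AEStronglyMeasurable.enorm ?_) 2
  have h1 : StronglyMeasurable f.toFun :=
    Finset.stronglyMeasurable_fun_sum _ fun i _ =>
      stronglyMeasurable_const.indicator measurableSet_Ioc
  have h2 : AEStronglyMeasurable (fun s => f.toFun s (b i)) (volume.restrict (Ioc (0 : ℝ) t)) :=
    ((ContinuousLinearMap.apply ℝ E (b i)).continuous.comp_stronglyMeasurable
      h1).aestronglyMeasurable
  exact h2.sub (((hΦ (b i)).mono Ioc_subset_Icc_self).aestronglyMeasurable measurableSet_Ioc)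

lemma Elementary.lintegral_hsNorm_sub_le [Countable ι] (b : HilbertBasis ι ℝ U)
    {Φ : ℝ → U →L[ℝ] E} (hΦ : ∀ u, ContinuousOn (fun s => Φ s u) (Icc 0 t))
    (f g : Elementary U E t) :
    ∫⁻ s in Ioc (0 : ℝ) t, hsNorm (f.toFun s - g.toFun s) ^ 2
      ≤ 2 * (∫⁻ s in Ioc (0 : ℝ) t, hsNorm (f.toFun s - Φ s) ^ 2)
        + 2 * ∫⁻ s in Ioc (0 : ℝ) t, hsNorm (g.toFun s - Φ s) ^ 2 := by
  rw [← lintegral_const_mul'' _ (f.aemeasurable_hsNorm_sub_sq b hΦ),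
    ← lintegral_const_mul'' _ (g.aemeasurable_hsNorm_sub_sq b hΦ),
    ← lintegral_add_left' ((f.aemeasurable_hsNorm_sub_sq b hΦ).const_mul _)]
  refine lintegral_mono fun s => ?_
  have h := hsNorm_add_sq_le (f.toFun s - Φ s) (-(g.toFun s - Φ s))
  rwa [hsNorm_neg, ← sub_eq_add_neg, sub_sub_sub_cancel_right] at h

end Approximation

/-! ### Existence and uniqueness of the stochastic integral -/

section StochasticIntegral

variable {U E Ω ι : Type*} [NormedAddCommGroup U] [InnerProductSpace ℝ U] [CompleteSpace U]
  [NormedAddCommGroup E] [InnerProductSpace ℝ E] [CompleteSpace E] [MeasurableSpace Ω]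
  {P : Measure Ω} {W : ℝ≥0 → U → Ω → ℝ} {t : ℝ≥0} [Countable ι]

/-- Two approximating sequences of `Φ` approach each other, and by the isometry so do their
integrals. -/
lemma IsStochasticIntegral.ae_eq (hW : IsCylindricalWiener W P) (b : HilbertBasis ι ℝ U)
    {Φ : ℝ → U →L[ℝ] E} (hΦ : ∀ u, ContinuousOn (fun s => Φ s u) (Icc 0 t)) {X Y : Ω → E}
    (hX : IsStochasticIntegral W P t Φ X) (hY : IsStochasticIntegral W P t Φ Y) : Y =ᵐ[P] X := by
  obtain ⟨hX2, f, hf, hfX⟩ := hX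
  obtain ⟨hY2, g, hg, hgY⟩ := hY
  have hfg : Tendsto (fun n => eLpNorm (fun ω => (f n).integral W ω - (g n).integral W ω) 2 P)
      atTop (𝓝 0) := by
    have h1 : Tendsto (fun n => eLpNorm (fun ω => (f n).integral W ω - (g n).integral W ω) 2 P ^ 2)
        atTop (𝓝 0) := by
      have h2 := (ENNReal.Tendsto.const_mul hf (Or.inr ENNReal.ofNat_ne_top) (a := 2)).add
        (ENNReal.Tendsto.const_mul hg (Or.inr ENNReal.ofNat_ne_top) (a := 2))
      rw [mul_zero, add_zero] at h2
      refine tendsto_of_tendsto_of_tendsto_of_le_of_le tendsto_const_nhds h2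
        (fun _ => zero_le) fun n => ?_
      simp only
      rw [Elementary.eLpNorm_integral_sub_sq hW]
      exact (f n).lintegral_hsNorm_sub_le b hΦ (g n)
    have h3 := (ENNReal.continuous_rpow_const (y := 1 / 2)).tendsto 0 |>.comp h1
    rw [ENNReal.zero_rpow_of_pos (by norm_num)] at h3
    refine h3.congr fun n => ?_
    rw [Function.comp_apply, ← ENNReal.rpow_natCast, ← ENNReal.rpow_mul]
    norm_num
  have hzero : eLpNorm (Y - X) 2 P = 0 := by
    have hlim := (hfX.add hfg).add hgY
    rw [add_zero, add_zero] at hlim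
    refine le_antisymm (ge_of_tendsto' hlim fun n => ?_) zero_le
    have mf := (f n).memLp_integral hW
    have mg := (g n).memLp_integral hW
    have e : Y - X = (((f n).integral W - X) - ((f n).integral W - (g n).integral W))
        - ((g n).integral W - Y) := by
      abel
    rw [e]
    refine (eLpNorm_sub_le ((mf.1.sub hX2.1).sub (mf.1.sub mg.1)) (mg.1.sub hY2.1)
      (by norm_num)).trans (add_le_add ?_ le_rfl)
    exact eLpNorm_sub_le (mf.1.sub hX2.1) (mf.1.sub mg.1) (by norm_num)
  have h := (eLpNorm_eq_zero_iff (hY2.1.sub hX2.1) (by norm_num)).1 hzero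
  filter_upwards [h] with ω hω
  exact sub_eq_zero.1 hω

/-- The isometry turns convergence of elementary integrands into a Cauchy sequence of integrals in
`L²`, which is complete. -/
lemma exists_isStochasticIntegral (hW : IsCylindricalWiener W P) (b : HilbertBasis ι ℝ U)
    {Φ : ℝ → U →L[ℝ] E} (hΦ : ∀ u, ContinuousOn (fun s => Φ s u) (Icc 0 t)) {c : ι → ℝ≥0∞}
    (hc : ∑' i, c i ≠ ∞) (hb : ∀ s ∈ Ioc (0 : ℝ) t, ∀ i, ‖Φ s (b i)‖ₑ ^ 2 ≤ c i) :
    ∃ X : Ω → E, IsStochasticIntegral W P t Φ X := by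
  -- With squared errors `4⁻ⁿ / 8`, squared distances beyond index `N` are at most `2 * 2 * 4⁻ᴺ / 8
  -- = 4⁻ᴺ / 2 < (2⁻ᴺ) ^ 2`, and the bounds `2⁻ᴺ` are summable.
  choose f hf using fun n : ℕ => exists_elementary_lintegral_le b hΦ hc hb
    (η := (1 / 4) ^ n / 8) (by positivity)
  have hcau : ∀ N n m : ℕ, N ≤ n → N ≤ m →
      eLpNorm ((f n).integral W - (f m).integral W) 2 P < ENNReal.ofReal ((1 / 2) ^ N) := by
    intro N n m hn hm
    refine lt_of_pow_lt_pow_left' 2 ?_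
    have hmono : ∀ k, N ≤ k → ∫⁻ s in Ioc (0 : ℝ) t, hsNorm ((f k).toFun s - Φ s) ^ 2
        ≤ ENNReal.ofReal ((1 / 4) ^ N / 8) := fun k hk => (hf k).trans
      (ENNReal.ofReal_le_ofReal (div_le_div_of_nonneg_right
        (pow_le_pow_of_le_one (by norm_num) (by norm_num) hk) (by norm_num)))
    calc eLpNorm ((f n).integral W - (f m).integral W) 2 P ^ 2
        = ∫⁻ s in Ioc (0 : ℝ) t, hsNorm ((f n).toFun s - (f m).toFun s) ^ 2 :=
          Elementary.eLpNorm_integral_sub_sq hW (f n) (f m)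
      _ ≤ 2 * ENNReal.ofReal ((1 / 4) ^ N / 8) + 2 * ENNReal.ofReal ((1 / 4) ^ N / 8) :=
          ((f n).lintegral_hsNorm_sub_le b hΦ (f m)).trans
            (add_le_add (mul_le_mul_right (hmono n hn) 2) (mul_le_mul_right (hmono m hm) 2))
      _ = ENNReal.ofReal ((1 / 4) ^ N / 2) := by
          rw [← ENNReal.ofReal_ofNat 2, ← ENNReal.ofReal_mul (by norm_num),
            ← ENNReal.ofReal_add (by positivity) (by positivity)]
          congr 1
          ring
      _ < ENNReal.ofReal ((1 / 2) ^ N) ^ 2 := by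
          rw [← ENNReal.ofReal_pow (by positivity), ← pow_mul, mul_comm N 2, pow_mul]
          norm_num only [one_div]
          refine (ENNReal.ofReal_lt_ofReal_iff (by positivity)).2 (half_lt_self (by positivity))
  obtain ⟨X, hX, hlim⟩ := Lp.cauchy_complete_eLpNorm (p := 2) (by norm_num)
    (fun n => (f n).memLp_integral hW) (B := fun n => ENNReal.ofReal ((1 / 2) ^ n))
    (by
      rw [← ENNReal.ofReal_tsum_of_nonneg (fun _ => by positivity) summable_geometric_two]
      exact ENNReal.ofReal_ne_top) hcau
  refine ⟨X, hX, f, ?_, hlim⟩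
  have h0 : Tendsto (fun n : ℕ => ENNReal.ofReal ((1 / 4) ^ n / 8)) atTop (𝓝 0) := by
    have := (tendsto_pow_atTop_nhds_zero_of_lt_one (r := (1 / 4 : ℝ)) (by norm_num)
      (by norm_num)).div_const 8
    rw [zero_div] at this
    simpa using ENNReal.tendsto_ofReal this
  exact tendsto_of_tendsto_of_tendsto_of_le_of_le tendsto_const_nhds h0 (fun _ => zero_le) hf

end StochasticIntegral

/-! ### The Hilbert-Schmidt bound for the damped wave semigroup -/

section Bound

variable {U ι : Type*} [NormedAddCommGroup U] [InnerProductSpace ℝ U] [CompleteSpace U]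
  {L : U →ₗ.[ℝ] U} {e : HilbertBasis ι ℝ U} {μ : ι → ℝ}

lemma enorm_semigroup_G_sq_le (hL : IsAdmissible L) (he : ∀ i, e i ∈ eigenspace L (μ i))
    {α ρ : ℝ} (hρ : 0 ≤ ρ) {S : ℝ → H hL →L[ℝ] H hL} (hS : Generates (waveOp hL α ρ) S) {t : ℝ}
    (ht : 0 ≤ t) (i : ι) : ‖((S t).comp (G hL)) (e i)‖ₑ ^ 2 ≤ ENNReal.ofReal (μ i)⁻¹ := by
  rw [enorm_sq_eq_ofReal]
  exact ENNReal.ofReal_le_ofReal (norm_semigroup_G_sq_le hL he hρ hS ht i)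

lemma IsAdmissible.tsum_ofReal_inv_ne_top (hL : IsAdmissible L)
    (he : ∀ i, e i ∈ eigenspace L (μ i)) : ∑' i, ENNReal.ofReal (μ i)⁻¹ ≠ ∞ := by
  rw [← ENNReal.ofReal_tsum_of_nonneg (fun i => inv_nonneg.2 (hL.eigenvalue_pos he i).le)
    (hL.summable_inv he)]
  exact ENNReal.ofReal_ne_top

/-- A summable family of strictly positive numbers has a countable index set. -/
lemma IsAdmissible.countable_eigenbasis (hL : IsAdmissible L)
    (he : ∀ i, e i ∈ eigenspace L (μ i)) : Countable ι := by
  have h := (hL.summable_inv he).countable_support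
  rw [Function.support_eq_univ fun i => (inv_pos.2 (hL.eigenvalue_pos he i)).ne'] at h
  exact countable_univ_iff.1 h

/-- The constant is `∑ (μ i)⁻¹`, the trace of `Λ⁻¹`. -/
lemma exists_hsNorm_semigroup_G_sq_le (hL : IsAdmissible L) {α ρ : ℝ} (hρ : 0 ≤ ρ)
    {S : ℝ → H hL →L[ℝ] H hL} (hS : Generates (waveOp hL α ρ) S) :
    ∃ C : ℝ≥0∞, C ≠ ∞ ∧ ∀ t, 0 ≤ t → hsNorm ((S t).comp (G hL)) ^ 2 ≤ C := by
  obtain ⟨ι, e, μ, he⟩ := hL.exists_eigenbasis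
  refine ⟨_, hL.tsum_ofReal_inv_ne_top he, fun t ht => ?_⟩
  rw [hsNorm_sq_eq e]
  exact ENNReal.tsum_le_tsum fun i => enorm_semigroup_G_sq_le hL he hρ hS ht i

lemma lintegral_rpow_lt_top {T γ : ℝ} (hγ : γ < 1 / 2) :
    ∫⁻ t in Ioc (0 : ℝ) T, ENNReal.ofReal (t ^ (-2 * γ)) < ∞ := by
  have h : IntegrableOn (fun t : ℝ => t ^ (-2 * γ)) (Ioc 0 T) :=
    (intervalIntegral.intervalIntegrable_rpow' (a := 0) (b := T) (by linarith)).1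
  exact h.lintegral_lt_top

end Bound

end DampedWave

end

/-! ### The theorem, from the uniform Hilbert-Schmidt bound -/

theorem mainTheorem7 {U : Type*} [NormedAddCommGroup U] [InnerProductSpace ℝ U] [CompleteSpace U]
    [TopologicalSpace.SeparableSpace U] (Λ : U →ₗ.[ℝ] U) (hΛ : DampedWave.IsAdmissible Λ)
    (ρ α : ℝ) (hρ : 0 < ρ) (hα₀ : 0 ≤ α) (hα₁ : α < 1)
    (hne : ∀ m : ℝ, DampedWave.IsEigenvalue Λ m → ρ ^ 2 ≠ 4 * m ^ (1 - 2 * α)) :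
    (∃ S : ℝ → DampedWave.H hΛ →L[ℝ] DampedWave.H hΛ,
      DampedWave.Generates (DampedWave.waveOp hΛ α ρ) S) ∧
    ∀ S : ℝ → DampedWave.H hΛ →L[ℝ] DampedWave.H hΛ,
      DampedWave.Generates (DampedWave.waveOp hΛ α ρ) S →
        (⨆ t ∈ Set.Ici (0 : ℝ), DampedWave.hsNorm ((S t).comp (DampedWave.G hΛ))) < ∞ ∧
        (∀ T : ℝ, 0 < T → ∀ γ ∈ Set.Ioo (0 : ℝ) (1 / 2),
          ∫⁻ t in Set.Ioc (0 : ℝ) T, ENNReal.ofReal (t ^ (-2 * γ)) *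
            DampedWave.hsNorm ((S t).comp (DampedWave.G hΛ)) ^ 2 < ∞) ∧
        ∀ (Ω : Type*) [MeasurableSpace Ω] (P : Measure Ω) [IsProbabilityMeasure P]
          (W : ℝ≥0 → U → Ω → ℝ), DampedWave.IsCylindricalWiener W P →
          ∀ t : ℝ≥0, ∃ X : Ω → DampedWave.H hΛ,
            DampedWave.IsStochasticIntegral W P t
              (fun s => (S (t - s)).comp (DampedWave.G hΛ)) X ∧
            ∀ Y : Ω → DampedWave.H hΛ,
              DampedWave.IsStochasticIntegral W P t
                (fun s => (S (t - s)).comp (DampedWave.G hΛ)) Y → Y =ᵐ[P] X := by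
  refine ⟨DampedWave.exists_generates_waveOp hΛ hρ.le, fun S hS => ?_⟩
  obtain ⟨C, hC, hSC⟩ := DampedWave.exists_hsNorm_semigroup_G_sq_le hΛ hρ.le hS
  refine ⟨?_, ?_, ?_⟩
  · have hlt : C ^ (1 / 2 : ℝ) < ∞ := ENNReal.rpow_lt_top_of_nonneg (by norm_num) hC
    refine lt_of_le_of_lt (iSup₂_le fun t ht => ?_) hlt
    have h := ENNReal.rpow_le_rpow (hSC t ht) (by norm_num : (0 : ℝ) ≤ 1 / 2)
    rw [← ENNReal.rpow_natCast, ← ENNReal.rpow_mul] at h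
    norm_num at h ⊢
    exact h
  · intro T _ γ hγ
    calc ∫⁻ t in Ioc (0 : ℝ) T, ENNReal.ofReal (t ^ (-2 * γ)) *
          DampedWave.hsNorm ((S t).comp (DampedWave.G hΛ)) ^ 2
        ≤ ∫⁻ t in Ioc (0 : ℝ) T, ENNReal.ofReal (t ^ (-2 * γ)) * C :=
          setLIntegral_mono' measurableSet_Ioc fun t ht => mul_le_mul_right (hSC t ht.1.le) _
      _ = (∫⁻ t in Ioc (0 : ℝ) T, ENNReal.ofReal (t ^ (-2 * γ))) * C :=
          lintegral_mul_const' _ _ hC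
      _ < ∞ := ENNReal.mul_lt_top (DampedWave.lintegral_rpow_lt_top hγ.2) hC.lt_top
  · intro Ω _ P _ W hW t
    obtain ⟨ι, e, μ, he⟩ := hΛ.exists_eigenbasis
    have : Countable ι := hΛ.countable_eigenbasis he
    -- Strong continuity of the semigroup is only available for nonnegative times, and `t - s ≥ 0`
    -- on `[0, t]`.
    have hcont : ∀ u, ContinuousOn
        (fun s => ((S (t - s)).comp (DampedWave.G hΛ)) u) (Icc (0 : ℝ) t) := fun u =>
      (hS.1.continuousOn (DampedWave.G hΛ u)).comp (by fun_prop) fun s hs => sub_nonneg.2 hs.2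
    obtain ⟨X, hX⟩ := DampedWave.exists_isStochasticIntegral hW e hcont
      (hΛ.tsum_ofReal_inv_ne_top he) fun s hs i =>
        DampedWave.enorm_semigroup_G_sq_le hΛ he hρ.le hS (sub_nonneg.2 hs.2) i
    exact ⟨X, hX, fun Y hY => DampedWave.IsStochasticIntegral.ae_eq hW e hcont hX hY⟩
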